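/- Let $(X,d)$ be a complete metric space, $\lambda\in\mathbb R$, and let $\phi:X\to(-\infty,\infty]$ be lower semi-continuous with $D(\phi):=\{\phi<\infty\}\neq\emptyset$. A minimal geodesic from $x$ to $y$ is a curve $\gamma:[0,1]\to X$ with $\gamma(0)=x$, $\gamma(1)=y$ and $d(\gamma(s),\gamma(t))=|s-t|\,d(x,y)$ for all $s,t$. We say that a function $f:X\to(-\infty,\infty]$ is $c$-convex along such a $\gamma$ (where $f(x),f(y)<\infty$) if $f(\gamma(t))\le(1-t)f(x)+tf(y)-\frac c2(1-t)t\,d^2(x,y)$ for all $t\in[0,1]$. Assume that $\phi$ is $\lambda$-convex: any $x,y\in D(\phi)$ are joined by some minimal geodesic along which $\phi$ is $\lambda$-convex. The local slope of $\phi$ at $x\in D(\phi)$ is $|\nabla\phi|(x):=\limsup_{y\to x}\max\{\phi(x)-\phi(y),0\}/d(x,y)$ ($:=0$ if $x$ is isolated). For $\tau>0$ let $J^\phi_\tau(x)$ be the set of points $z\in X$ that attain $\phi_\tau(x):=\inf_{z\in X}\{\phi(z)+d^2(x,z)/(2\tau)\}$. A discrete solution from $x_0$ for a partition $0=t^0<t^1<\cdots\to\infty$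 is a sequence with $x^0=x_0$ and $x^k\in J^\phi_{t^k-t^{k-1}}(x^{k-1})$ for $k\ge1$; its interpolation is $\bar x(0)=x_0$, $\bar x(t)=x^k$ for $t\in(t^{k-1},t^k]$. A gradient curve of $\phi$ from $x_0$ is a curve $\xi:[0,\infty)\to X$ which is the pointwise limit of interpolations of discrete solutions from $x_0$ for some sequence of partitions with mesh $\sup_k(t^k-t^{k-1})$ tending to $0$. **Theorem.** Let $x_0\in D(\phi)$. (a) Assume either (I) $(X,d)$ is a $\mathrm{CAT}(1)$-space with $\operatorname{diam}X<\pi/2$, or (II) there are $K\in\mathbb R$ and a family $\Gamma$ of minimal geodesics joining any two points of $X$ such that: every $d^2(p,\cdot)$, $p\in X$, is $K$-convex along every $\gamma\in\Gamma$; $\phi$ is $\lambda$-convex along every $\gamma\in\Gamma$ with end points in $D(\phi)$; and for all $\gamma,\eta\in\Gamma$ with $\gamma(0)=\eta(0)=x$, $\gamma(1)=y$, $\eta(1)=z$ the following limits exist and satisfy $$\lim_{s\downarrow0}\frac{d^2(\gamma(s),z)-d^2(x,z)}{s}=\lim_{t\downarrow0}\frac{d^2(\eta(t),y)-d^2(x,y)}{t};$$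 and moreover $\phi$ is coercive: there is $\tau_*\in(0,\infty]$ such that $\phi_\tau(x)>-\infty$ and $J^\phi_\tau(x)\ne\emptyset$ for all $x\in X$ and $\tau\in(0,\tau_*)$. Then there is exactly one gradient curve $\xi$ of $\phi$ from $x_0$ and, writing $G(t,x_0):=\xi(t)$, $$|\nabla\phi|(x_0)=0\iff G(t,x_0)=x_0\ \text{ for all }t>0 .$$ (b) If $(X,d)$ is a $\mathrm{CAT}(1)$-space of arbitrary diameter, the same holds for the flow $G$ obtained by restarting: there is exactly one curve $\xi:[0,\infty)\to X$ with $\xi(0)=x_0$ for which there are times $0=s_0,s_1,\dots$ exhausting $[0,\infty)$ (the last one possibly $\infty$) such that, for each finite $s_i$, $\xi(s_i+\cdot)$ agrees up to time $s_{i+1}$ with a gradient curve from $\xi(s_i)$ of the restriction of $\phi$ to the closed ball of radius $\pi/6$ around $\xi(s_i)$ (set to $\infty$ outside it), $s_{i+1}$ being the first time that this gradient curve is at distance $\pi/6$ from $\xi(s_i)$ ($s_{i+1}=\infty$ if there is none). With $G(t,x_0):=\xi(t)$, $$|\nabla\phi|(x_0)=0\iff G(t,x_0)=x_0\ \text{ for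 all }t>0 .$$ -/

import Mathlib

open Set Filter Topology
open scoped NNReal ENNReal

noncomputable section

namespace GradFlow

/-! ### Geodesics and CAT(1)-spaces -/

/-- The restriction of `γ` to `[0,1]` is a minimal geodesic from `x` to `y`, for the distance `d`. -/
def IsMinGeodesic {Y : Type*} (d : Y → Y → ℝ) (γ : ℝ → Y) (x y : Y) : Prop :=
  γ 0 = x ∧ γ 1 = y ∧
    ∀ s ∈ Icc (0 : ℝ) 1, ∀ t ∈ Icc (0 : ℝ) 1, d (γ s) (γ t) = |s - t| * d x y

/-- The unit sphere in Euclidean 3-space. -/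
abbrev S2 : Type := Metric.sphere (0 : EuclideanSpace ℝ (Fin 3)) 1

/-- The angular (intrinsic Riemannian) distance on the unit sphere. -/
def sphereDist (a b : S2) : ℝ :=
  InnerProductGeometry.angle (a : EuclideanSpace ℝ (Fin 3)) (b : EuclideanSpace ℝ (Fin 3))

/-- CAT(1)-spaces: geodesic metric spaces in which every triangle of perimeter `< 2π` is at least as
thin as its comparison triangle in the unit sphere. The comparison triangle `x' y' z'` exists and is
unique up to rigid motions, and its side `γ'` is the unique minimal geodesic from `y'` to `z'`. -/
def IsCAT1 (X : Type*) [MetricSpace X] : Prop :=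
  (∀ x y : X, ∃ γ : ℝ → X, IsMinGeodesic dist γ x y) ∧
  ∀ x y z : X, dist x y + dist y z + dist z x < 2 * Real.pi →
    ∀ γ : ℝ → X, IsMinGeodesic dist γ y z →
      ∃ x' y' z' : S2, sphereDist x' y' = dist x y ∧ sphereDist y' z' = dist y z ∧
        sphereDist z' x' = dist z x ∧
        ∃ γ' : ℝ → S2, IsMinGeodesic sphereDist γ' y' z' ∧
          ∀ t ∈ Icc (0 : ℝ) 1, dist x (γ t) ≤ sphereDist x' (γ' t)

section Potential

variable {X : Type*} [MetricSpace X]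

/-! ### Potentials: the values are in `(-∞,∞]`, i.e. `⊥` is excluded wherever these are used. -/

/-- The effective domain `D(φ)`. -/
def dom (φ : X → EReal) : Set X := {x | φ x ≠ ⊤}

/-- The Moreau--Yosida approximation `φ_τ(x)`. -/
def moreauYosida (φ : X → EReal) (τ : ℝ) (x : X) : EReal :=
  ⨅ z : X, φ z + ((dist x z ^ 2 / (2 * τ) : ℝ) : EReal)

/-- The set of minimizers in the Moreau--Yosida approximation. -/
def proxSet (φ : X → EReal) (τ : ℝ) (x : X) : Set X :=
  {z | φ z + ((dist x z ^ 2 / (2 * τ) : ℝ) : EReal) = moreauYosida φ τ x}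

/-- Coercivity; the threshold `τs` ranges over `(0,∞]`. -/
def Coercive (φ : X → EReal) : Prop :=
  ∃ τs : ℝ≥0∞, 0 < τs ∧ ∀ (x : X) (τ : ℝ), 0 < τ → ENNReal.ofReal τ < τs →
    moreauYosida φ τ x ≠ ⊥ ∧ (proxSet φ τ x).Nonempty

/-- The `c`-convexity inequality of `φ` along the curve `γ` joining the points `x, y` of `D(φ)`. -/
def ConvexAlong (φ : X → EReal) (c : ℝ) (γ : ℝ → X) (x y : X) : Prop :=
  ∀ t ∈ Icc (0 : ℝ) 1, φ (γ t) ≤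
    (((1 - t) * (φ x).toReal + t * (φ y).toReal - c / 2 * (1 - t) * t * dist x y ^ 2 : ℝ) : EReal)

/-- `φ` is `c`-convex: any two points of `D(φ)` are joined by some minimal geodesic along which the
`c`-convexity inequality holds. -/
def IsLambdaConvex (φ : X → EReal) (c : ℝ) : Prop :=
  ∀ x ∈ dom φ, ∀ y ∈ dom φ, ∃ γ : ℝ → X, IsMinGeodesic dist γ x y ∧ ConvexAlong φ c γ x y

/-- Commutativity for `γ` from `x` to `y` and `η` from `x` to `z`: the one-sided derivatives at `0` of
`d²(γ(s),z)` and of `d²(η(t),y)` exist and are equal. -/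
def CommuteAlong (γ η : ℝ → X) (x y z : X) : Prop :=
  ∃ L : ℝ,
    Tendsto (fun s : ℝ => (dist (γ s) z ^ 2 - dist x z ^ 2) / s) (𝓝[>] 0) (𝓝 L) ∧
    Tendsto (fun t : ℝ => (dist (η t) y ^ 2 - dist x y ^ 2) / t) (𝓝[>] 0) (𝓝 L)

/-- There is a family `Γ` of minimal geodesics joining any two points of the space, such that, along
this same family, commutativity holds, all squared distance functions `d²(p,·)` are `K`-convex, and
`φ` is `c`-convex. -/
def CommutativeSetting (φ : X → EReal) (c K : ℝ) : Prop :=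
  ∃ Γ : Set (ℝ → X),
    (∀ γ ∈ Γ, IsMinGeodesic dist γ (γ 0) (γ 1)) ∧
    (∀ x y : X, ∃ γ ∈ Γ, γ 0 = x ∧ γ 1 = y) ∧
    (∀ γ ∈ Γ, ∀ η ∈ Γ, γ 0 = η 0 → CommuteAlong γ η (γ 0) (γ 1) (η 1)) ∧
    (∀ γ ∈ Γ, ∀ p : X, ConvexAlong (fun w => ((dist p w ^ 2 : ℝ) : EReal)) K γ (γ 0) (γ 1)) ∧
    (∀ γ ∈ Γ, γ 0 ∈ dom φ → γ 1 ∈ dom φ → ConvexAlong φ c γ (γ 0) (γ 1))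

/-- The descending local slope `|∇φ|(x) = limsup_{y → x} max{φ(x) - φ(y), 0} / d(x,y)`
(it is `0` at isolated points). -/
def localSlope (φ : X → EReal) (x : X) : ℝ≥0∞ :=
  limsup (fun y => (max (φ x - φ y) 0).toENNReal / edist x y) (𝓝[≠] x)

/-! ### Discrete solutions and gradient curves -/

/-- Partitions `0 = p 0 < p 1 < ⋯ → ∞` of `[0,∞)`. -/
def IsPartition (p : ℕ → ℝ) : Prop :=
  p 0 = 0 ∧ StrictMono p ∧ Tendsto p atTop atTop

/-- The mesh of a partition. -/
def mesh (p : ℕ → ℝ) : ℝ≥0∞ := ⨆ k : ℕ, ENNReal.ofReal (p (k + 1) - p k)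

/-- Discrete solutions starting from `x₀` associated with the partition `p`. -/
def IsDiscreteSolution (φ : X → EReal) (x₀ : X) (p : ℕ → ℝ) (x : ℕ → X) : Prop :=
  x 0 = x₀ ∧ ∀ k : ℕ, x (k + 1) ∈ proxSet φ (p (k + 1) - p k) (x k)

/-- The interpolated curve: it is `x 0` at `t = 0` and `x k` for `p (k-1) < t ≤ p k`. -/
def interpolate (p : ℕ → ℝ) (x : ℕ → X) (t : ℝ≥0) : X := x (sInf {k : ℕ | (t : ℝ) ≤ p k})

/-- `ξ` is a gradient curve of `φ` starting from `x₀`: it is the pointwise limit of the interpolations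
of discrete solutions starting from `x₀`, along a sequence of partitions with mesh tending to `0`. -/
def IsGradientCurve (φ : X → EReal) (x₀ : X) (ξ : ℝ≥0 → X) : Prop :=
  ∃ (p : ℕ → ℕ → ℝ) (x : ℕ → ℕ → X),
    (∀ i, IsPartition (p i)) ∧ Tendsto (fun i => mesh (p i)) atTop (𝓝 0) ∧
    (∀ i, IsDiscreteSolution φ x₀ (p i) (x i)) ∧
    ∀ t : ℝ≥0, Tendsto (fun i => interpolate (p i) (x i) t) atTop (𝓝 (ξ t))

/-- The gradient flow operator: `gradientFlow φ t x₀ = ξ t` for the gradient curve `ξ` starting from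
`x₀` (to be used when this curve exists and is unique). -/
def gradientFlow (φ : X → EReal) (t : ℝ≥0) (x₀ : X) : X :=
  (@Classical.epsilon (ℝ≥0 → X) ⟨fun _ => x₀⟩ (IsGradientCurve φ x₀)) t

/-! ### The flow obtained by restarting the construction in balls of radius `π / 6` -/

open Classical in
/-- The potential `φ` restricted to the closed ball of centre `c` and radius `π / 6`
(and put equal to `∞` elsewhere). -/
def restrictBall (φ : X → EReal) (c : X) : X → EReal :=
  fun z => if dist z c ≤ Real.pi / 6 then φ z else ⊤

/-- The first time (possibly `∞`) at which `η` is at distance `π / 6` from `c`. -/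
def hittingTime (c : X) (η : ℝ≥0 → X) : ℝ≥0∞ :=
  ⨅ (t : ℝ≥0) (_ : dist (η t) c = Real.pi / 6), (t : ℝ≥0∞)

/-- `ξ` is the curve obtained from `x₀` by restarting: there are times `0 = s 0, s 1, …` exhausting
`[0,∞)` (the last one may be `∞`), such that from each finite `s i` on, `ξ` follows a gradient
curve `η` of `φ` restricted to the `π / 6`-ball around `ξ (s i)`, until `η` hits the boundary of
that ball, at the time `s (i+1)`. -/
def IsRestartedCurve (φ : X → EReal) (x₀ : X) (ξ : ℝ≥0 → X) : Prop :=
  ξ 0 = x₀ ∧ ∃ s : ℕ → ℝ≥0∞, s 0 = 0 ∧ (∀ t : ℝ≥0, ∃ i, (t : ℝ≥0∞) < s i) ∧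
    ∀ i, ∀ a : ℝ≥0, s i = a →
      ∃ η : ℝ≥0 → X, IsGradientCurve (restrictBall φ (ξ a)) (ξ a) η ∧
        s (i + 1) = s i + hittingTime (ξ a) η ∧
        ∀ t : ℝ≥0, ((a + t : ℝ≥0) : ℝ≥0∞) ≤ s (i + 1) → ξ (a + t) = η t

/-- The flow operator given by the restarted curves (to be used when these exist and are unique). -/
def restartedFlow (φ : X → EReal) (t : ℝ≥0) (x₀ : X) : X :=
  (@Classical.epsilon (ℝ≥0 → X) ⟨fun _ => x₀⟩ (IsRestartedCurve φ x₀)) t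

end Potential

end GradFlow

end

open GradFlow

/-! All cases reduce to one discrete evolution variational inequality (EVI), the field `evi` of
`FlowSetting`: a minimizer `z` of step `τ` from `x` satisfies `d²(z,y) ≤ d²(x,y) + C d²(x,z) +
2τ(φ(y) - φ(z)) + Lτ d²(z,y)`. The term `C d²(x,z)` is the price of curvature. Minimality gives
`d²(x,z) ≤ 2τ(φ(x) - φ(z))`, so along a discrete solution of mesh `ε` these errors sum to at most
`2Cε` times the drop of `φ`, and vanish in the limit.

Convergence and uniqueness: adding the EVIs of two discrete solutions, each tested at a point of the
other, cancels the potentials and leaves a double-index recursion for their squared distances,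
solved as in the Crandall-Liggett theorem (`double_index_estimate`,
`FlowSetting.exists_comparison`).

Stationarity: both conditions are equivalent to a global bound `φ(x₀) - φ(y) ≤ c d²(x₀,y)`. Zero
slope gives it by convexity along a geodesic to `y`. The bound forces small steps to stay at `x₀`.
Conversely, integrating the EVI along a constant limit curve recovers such a bound
(`FlowSetting.val_sub_le_of_stationary`).

The EVI comes from a first variation at `z`: minimality and convexity of `φ` bound the growth of
`d²(x,·)` towards `y` from below, while geometry bounds it from above, by comparison with the sphere
(`IsCAT1.first_variation_le`) or by commutativity and `K`-convexity
(`CommutativeSetting.flowSetting`).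

For arbitrary diameter, `π/6`-balls are convex and of diameter at most `π/3`, so the theory applies
to the restricted potential. Restart times cannot accumulate: each restart covers distance `π/6`,
and a quadratic lower bound on `φ` limits the distance covered in a short time
(`restart_times_unbounded`). -/

namespace GradFlow

/-! ### Minimizers and the abstract flow setting -/

section Basic

variable {X : Type*} {φ : X → EReal}

/-- The real value of the potential, meaningful on its domain. -/
abbrev val (φ : X → EReal) (x : X) : ℝ := (φ x).toReal

lemma coe_val (hbot : ∀ x, φ x ≠ ⊥) {x : X} (hx : x ∈ dom φ) : ((val φ x : ℝ) : EReal) = φ x :=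
  EReal.coe_toReal hx (hbot x)

lemma mem_dom_of_le {x : X} {c : ℝ} (h : φ x ≤ c) : x ∈ dom φ := by
  intro h'
  rw [h'] at h
  exact absurd (top_le_iff.1 h) (EReal.coe_ne_top c)

lemma val_le_of_le (hbot : ∀ x, φ x ≠ ⊥) {x : X} {c : ℝ} (h : φ x ≤ c) : val φ x ≤ c := by
  rw [← coe_val hbot (mem_dom_of_le h)] at h
  exact_mod_cast h

variable [MetricSpace X]

lemma mem_dom_and_val_le_of_tendsto (hbot : ∀ x, φ x ≠ ⊥) (hlsc : LowerSemicontinuous φ)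
    {ι : Type*} {l : Filter ι} [NeBot l] {u : ι → X} {x : X} {b : ι → ℝ} {c : ℝ}
    (hu : Tendsto u l (𝓝 x)) (hd : ∀ᶠ i in l, u i ∈ dom φ)
    (h : ∀ᶠ i in l, val φ (u i) ≤ b i) (hb : Tendsto b l (𝓝 c)) :
    x ∈ dom φ ∧ val φ x ≤ c := by
  have key : φ x ≤ c := by
    by_contra hc
    push Not at hc
    obtain ⟨r, hr1, hr2⟩ := EReal.lt_iff_exists_real_btwn.1 hc
    have hr1' : c < r := by exact_mod_cast hr1
    have h1 := hu.eventually (hlsc x _ hr2)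
    have h2 := hb.eventually (gt_mem_nhds hr1')
    obtain ⟨i, hi1, hi2, hi3, hi4⟩ := (h1.and (h2.and (hd.and h))).exists
    rw [← coe_val hbot hi3] at hi1
    have : r < val φ (u i) := by exact_mod_cast hi1
    linarith
  exact ⟨mem_dom_of_le key, val_le_of_le hbot key⟩

lemma prox_spec (hbot : ∀ x, φ x ≠ ⊥) {x₁ : X} (hx₁ : x₁ ∈ dom φ) {τ : ℝ} {x z : X}
    (hz : z ∈ proxSet φ τ x) :
    z ∈ dom φ ∧ ∀ y ∈ dom φ,
      val φ z + dist x z ^ 2 / (2 * τ) ≤ val φ y + dist x y ^ 2 / (2 * τ) := by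
  have hle : ∀ y, φ z + ((dist x z ^ 2 / (2 * τ) : ℝ) : EReal) ≤
      φ y + ((dist x y ^ 2 / (2 * τ) : ℝ) : EReal) := fun y => by
    have : φ z + ((dist x z ^ 2 / (2 * τ) : ℝ) : EReal) = moreauYosida φ τ x := hz
    rw [this]
    exact iInf_le _ y
  have hzd : z ∈ dom φ := by
    intro h
    have h1 := hle x₁
    rw [h, EReal.top_add_coe, ← coe_val hbot hx₁, ← EReal.coe_add] at h1
    exact absurd (top_le_iff.1 h1) (EReal.coe_ne_top _)
  refine ⟨hzd, fun y hy => ?_⟩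
  have h1 := hle y
  rw [← coe_val hbot hzd, ← coe_val hbot hy, ← EReal.coe_add, ← EReal.coe_add] at h1
  exact_mod_cast h1

lemma mem_proxSet (hbot : ∀ x, φ x ≠ ⊥) {τ : ℝ} {x z : X} (hz : z ∈ dom φ)
    (h : ∀ y ∈ dom φ, val φ z + dist x z ^ 2 / (2 * τ) ≤ val φ y + dist x y ^ 2 / (2 * τ)) :
    z ∈ proxSet φ τ x := by
  refine le_antisymm (le_iInf fun y => ?_) (iInf_le _ z)
  by_cases hy : y ∈ dom φ
  · rw [← coe_val hbot hz, ← coe_val hbot hy, ← EReal.coe_add, ← EReal.coe_add]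
    exact_mod_cast h y hy
  · have : φ y = ⊤ := by simpa [dom] using hy
    rw [this, EReal.top_add_coe]
    exact le_top

/-- The conditions under which the minimizing movement scheme is shown to converge: short time
minimizers exist, and they satisfy a discrete evolution variational inequality. -/
structure FlowSetting (φ : X → EReal) (C L : ℝ) : Prop where
  bot : ∀ x, φ x ≠ ⊥
  lsc : LowerSemicontinuous φ
  C_nonneg : 0 ≤ C
  L_nonneg : 0 ≤ L
  prox : ∃ τs > 0, ∀ x ∈ dom φ, ∀ τ, 0 < τ → τ < τs → (proxSet φ τ x).Nonempty
  evi : ∀ τ, 0 < τ → ∀ x ∈ dom φ, ∀ y ∈ dom φ, ∀ z ∈ proxSet φ τ x,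
    dist z y ^ 2 ≤ dist x y ^ 2 + C * dist x z ^ 2 + 2 * τ * (val φ y - val φ z)
      + L * τ * dist z y ^ 2

/-! ### Estimates for one discrete solution -/

namespace IsDiscreteSolution

variable {x₀ : X} {p : ℕ → ℝ} {x : ℕ → X}

lemma mem_dom (hx : IsDiscreteSolution φ x₀ p x) (hbot : ∀ x, φ x ≠ ⊥) (hx₀ : x₀ ∈ dom φ) (k : ℕ) :
    x k ∈ dom φ := by
  induction k with
  | zero => rw [hx.1]; exact hx₀
  | succ k ih => exact (prox_spec hbot ih (hx.2 k)).1

lemma step (hx : IsDiscreteSolution φ x₀ p x) (hbot : ∀ x, φ x ≠ ⊥) (hx₀ : x₀ ∈ dom φ)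
    (hp : IsPartition p) (k : ℕ) :
    dist (x k) (x (k + 1)) ^ 2 ≤ 2 * (p (k + 1) - p k) * (val φ (x k) - val φ (x (k + 1))) := by
  have hk := hx.mem_dom hbot hx₀ k
  have h := (prox_spec hbot hk (hx.2 k)).2 _ hk
  have hτ : 0 < p (k + 1) - p k := sub_pos.2 (hp.2.1 (Nat.lt_succ_self k))
  rw [dist_self] at h
  have h2 : dist (x k) (x (k + 1)) ^ 2 / (2 * (p (k + 1) - p k)) ≤
      val φ (x k) - val φ (x (k + 1)) := by
    simp only [ne_eq, OfNat.ofNat_ne_zero, not_false_eq_true, zero_pow, zero_div, add_zero] at h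
    linarith
  rw [div_le_iff₀ (by positivity)] at h2
  linarith

lemma val_antitone (hx : IsDiscreteSolution φ x₀ p x) (hbot : ∀ x, φ x ≠ ⊥) (hx₀ : x₀ ∈ dom φ)
    (hp : IsPartition p) : Antitone fun k => val φ (x k) := by
  refine antitone_nat_of_succ_le fun k => ?_
  have h := hx.step hbot hx₀ hp k
  have hτ : 0 < p (k + 1) - p k := sub_pos.2 (hp.2.1 (Nat.lt_succ_self k))
  by_contra hc
  push Not at hc
  nlinarith [sq_nonneg (dist (x k) (x (k + 1)))]

lemma val_le (hx : IsDiscreteSolution φ x₀ p x) (hbot : ∀ x, φ x ≠ ⊥) (hx₀ : x₀ ∈ dom φ)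
    (hp : IsPartition p) (k : ℕ) : val φ (x k) ≤ val φ x₀ := by
  have := hx.val_antitone hbot hx₀ hp (Nat.zero_le k)
  simpa [hx.1] using this

end IsDiscreteSolution

/-- Cauchy-Schwarz for action against time: chaining steps with `d² ≤ 2 · time · drop` keeps the
constant 2, however many steps are taken. -/
lemma sq_add_le_of_sq_le {p q t s A B : ℝ} (ht : 0 ≤ t) (hs : 0 ≤ s) (hA : 0 ≤ A) (hB : 0 ≤ B)
    (h1 : p ^ 2 ≤ 2 * t * A) (h2 : q ^ 2 ≤ 2 * s * B) :
    (p + q) ^ 2 ≤ 2 * (t + s) * (A + B) := by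
  have h5 : p * q ≤ t * B + s * A := by
    refine abs_le_of_sq_le_sq' ?_ (by positivity) |>.2
    have : p ^ 2 * q ^ 2 ≤ (2 * t * A) * (2 * s * B) := by gcongr
    nlinarith [sq_nonneg (t * B - s * A)]
  nlinarith

namespace IsDiscreteSolution

variable {x₀ : X} {p : ℕ → ℝ} {x : ℕ → X}

lemma sq_dist_le (hx : IsDiscreteSolution φ x₀ p x) (hbot : ∀ x, φ x ≠ ⊥) (hx₀ : x₀ ∈ dom φ)
    (hp : IsPartition p) {j k : ℕ} (hjk : j ≤ k) :
    dist (x j) (x k) ^ 2 ≤ 2 * (p k - p j) * (val φ (x j) - val φ (x k)) := by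
  induction k, hjk using Nat.le_induction with
  | base => simp
  | succ k hk ih =>
    have := sq_add_le_of_sq_le (sub_nonneg.2 (hp.2.1.monotone hk))
      (sub_nonneg.2 (hp.2.1.monotone (Nat.le_succ k)))
      (sub_nonneg.2 (hx.val_antitone hbot hx₀ hp hk))
      (sub_nonneg.2 (hx.val_antitone hbot hx₀ hp (Nat.le_succ k))) ih (hx.step hbot hx₀ hp k)
    calc dist (x j) (x (k + 1)) ^ 2 ≤ (dist (x j) (x k) + dist (x k) (x (k + 1))) ^ 2 := by
          gcongr; exact dist_triangle _ _ _
      _ ≤ _ := this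
      _ = _ := by ring

/-- The error `C d²` is traded for `2Cτ` times the drop in this step, a form that telescopes under
summation. -/
lemma evi (hx : IsDiscreteSolution φ x₀ p x) {C L : ℝ} (S : FlowSetting φ C L) (hx₀ : x₀ ∈ dom φ)
    (hp : IsPartition p) (k : ℕ) {y : X} (hy : y ∈ dom φ) :
    dist (x (k + 1)) y ^ 2 ≤ dist (x k) y ^ 2
      + (p (k + 1) - p k) * (2 * C * (val φ (x k) - val φ (x (k + 1)))
        + 2 * (val φ y - val φ (x (k + 1))) + L * dist (x (k + 1)) y ^ 2) := by
  have h1 := S.evi _ (sub_pos.2 (hp.2.1 (Nat.lt_succ_self k))) _ (hx.mem_dom S.bot hx₀ k) _ hy _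
    (hx.2 k)
  have h2 := mul_le_mul_of_nonneg_left (hx.step S.bot hx₀ hp k) S.C_nonneg
  linarith

end IsDiscreteSolution

namespace FlowSetting

variable {C L : ℝ}

lemma exists_lower_bound (S : FlowSetting φ C L) {x : X} (hx : x ∈ dom φ) :
    ∃ A B : ℝ, 0 < A ∧ 0 < B ∧ ∀ y ∈ dom φ, val φ x - val φ y ≤ A + B * dist x y ^ 2 := by
  obtain ⟨τs, hτs, h⟩ := S.prox
  obtain ⟨z, hz⟩ := h x hx (τs / 2) (by positivity) (by linarith)
  have hz' := (prox_spec S.bot hx hz).2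
  -- Every `y` competes with the single minimizer `z` of step `τs / 2`, whence the coefficient `1 /
  -- τs`.
  refine ⟨|val φ x - val φ z| + 1, 1 / τs, by positivity, by positivity, fun y hy => ?_⟩
  have h1 := hz' y hy
  have h2 : (0 : ℝ) ≤ dist x z ^ 2 / (2 * (τs / 2)) := by positivity
  have h3 : dist x y ^ 2 / (2 * (τs / 2)) = 1 / τs * dist x y ^ 2 := by field_simp
  have := le_abs_self (val φ x - val φ z)
  linarith

/-- The a priori bound on the drop of the potential along discrete solutions. -/
lemma exists_drop_bound (S : FlowSetting φ C L) {x₀ : X} (hx₀ : x₀ ∈ dom φ) (T : ℝ) :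
    ∃ ε₀ > 0, ∃ M ≥ 0, ∀ p x, IsPartition p → IsDiscreteSolution φ x₀ p x →
      (∀ k, p (k + 1) - p k ≤ ε₀) → ∀ k, p k ≤ T → val φ x₀ - val φ (x k) ≤ M := by
  obtain ⟨A, B, hA, hB, hAB⟩ := S.exists_lower_bound hx₀
  have hC := S.C_nonneg
  have hL := S.L_nonneg
  set R := 2 * (1 + C) * B + L with hR
  have hRpos : 0 < R := by positivity
  refine ⟨1 / (2 * R), by positivity, A * Real.exp (2 * R * T), by positivity, ?_⟩
  intro p x hp hx hm k hk
  -- Discrete Grönwall: `A + B d²(x₀, x k)` dominates the drop, and by the EVI tested at `x₀` the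
  -- drop drives the growth of `d²(x₀, x k)` at rate `R`. The bound `ε₀ = 1/(2R)` on the steps gives
  -- `(1 - Rτ)⁻¹ ≤ 1 + 2Rτ`.
  have key : ∀ k, A + B * dist x₀ (x k) ^ 2 ≤ A * Real.exp (2 * R * p k) := by
    intro k
    induction k with
    | zero => simp [hx.1, hp.1]
    | succ k ih =>
      have h1 := hx.evi S hx₀ hp k hx₀
      have hτ : 0 < p (k + 1) - p k := sub_pos.2 (hp.2.1 (Nat.lt_succ_self k))
      set τ := p (k + 1) - p k with hτd
      have h2 := hx.val_le S.bot hx₀ hp k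
      have h3 := hAB _ (hx.mem_dom S.bot hx₀ (k + 1))
      rw [dist_comm (x (k + 1)), dist_comm (x k)] at h1
      set D := dist x₀ (x (k + 1)) ^ 2
      have hD : 0 ≤ D := by positivity
      have h4 : 2 * C * (val φ (x k) - val φ (x (k + 1))) + 2 * (val φ x₀ - val φ (x (k + 1)))
          + L * D ≤ 2 * (1 + C) * (A + B * D) + L * D := by
        nlinarith
      have h5 : B * (2 * (1 + C) * (A + B * D) + L * D) ≤ R * (A + B * D) := by
        rw [hR]; nlinarith [mul_nonneg hL hA.le]
      have h6 : A + B * D ≤ A + B * dist x₀ (x k) ^ 2 + R * τ * (A + B * D) := by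
        nlinarith [mul_le_mul_of_nonneg_left h4 (mul_nonneg hτ.le hB.le),
          mul_le_mul_of_nonneg_left h5 hτ.le]
      have h7 : R * τ ≤ 1 / 2 := by
        have := hm k
        rw [le_div_iff₀ (by positivity)] at this
        linarith
      have h8 : p (k + 1) = p k + τ := by rw [hτd]; ring
      rw [h8, mul_add, Real.exp_add]
      have h9 := Real.add_one_le_exp (2 * R * τ)
      have h10 : A + B * D ≤ (A + B * dist x₀ (x k) ^ 2) * (1 + 2 * R * τ) := by
        have h11 : (A + B * D) * (1 - R * τ) ≤ A + B * dist x₀ (x k) ^ 2 := by linarith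
        have h12 : 1 ≤ (1 - R * τ) * (1 + 2 * R * τ) := by nlinarith [mul_pos hRpos hτ]
        have h13 : 0 ≤ A + B * D := by positivity
        nlinarith [mul_pos hRpos hτ]
      calc A + B * D ≤ (A + B * dist x₀ (x k) ^ 2) * (1 + 2 * R * τ) := h10
        _ ≤ (A * Real.exp (2 * R * p k)) * Real.exp (2 * R * τ) := by gcongr; linarith
        _ = _ := by ring
  calc val φ x₀ - val φ (x k) ≤ A + B * dist x₀ (x k) ^ 2 := hAB _ (hx.mem_dom S.bot hx₀ k)
    _ ≤ _ := key k
    _ ≤ _ := by gcongr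

end FlowSetting

end Basic

/-! ### Comparison of two discrete solutions -/

lemma exp_neg_le_one_sub_half {y : ℝ} (h0 : 0 ≤ y) (h1 : y ≤ 1) : Real.exp (-y) ≤ 1 - y / 2 := by
  have h := Real.add_one_le_exp y
  have h2 : Real.exp (-y) * Real.exp y = 1 := by rw [← Real.exp_add]; simp
  have h3 := Real.exp_pos (-y)
  have h4 : Real.exp (-y) * (1 + y) ≤ 1 := by nlinarith
  have h5 : 1 ≤ (1 - y / 2) * (1 + y) := by nlinarith
  nlinarith

/-- The radicands satisfy `σP + τQ = (σ+τ)R - στ(2ε - σ - τ)`, and both steps are at most `ε`;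
concavity of the root does the rest. Thus `√((t-s)² + ε(t+s))` is a supersolution of the
double-index recursion. -/
lemma kobayashi_sqrt_step {D σ τ ε S : ℝ} (hσ : 0 < σ) (hτ : 0 < τ) (hσε : σ ≤ ε) (hτε : τ ≤ ε)
    (hS : σ + τ ≤ S) :
    σ * √((D - τ) ^ 2 + ε * (S - τ)) + τ * √((D + σ) ^ 2 + ε * (S - σ)) ≤
      (σ + τ) * √(D ^ 2 + ε * S) := by
  have hε : 0 < ε := hσ.trans_le hσε
  have hP : 0 ≤ (D - τ) ^ 2 + ε * (S - τ) :=
    add_nonneg (sq_nonneg _) (mul_nonneg hε.le (by linarith))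
  have hQ : 0 ≤ (D + σ) ^ 2 + ε * (S - σ) :=
    add_nonneg (sq_nonneg _) (mul_nonneg hε.le (by linarith))
  have hR : 0 ≤ D ^ 2 + ε * S := add_nonneg (sq_nonneg _) (mul_nonneg hε.le (by linarith))
  set P := (D - τ) ^ 2 + ε * (S - τ) with hPd
  set Q := (D + σ) ^ 2 + ε * (S - σ) with hQd
  set R := D ^ 2 + ε * S with hRd
  refine abs_le_of_sq_le_sq' ?_ (by positivity) |>.2
  have e1 := Real.sq_sqrt hP
  have e2 := Real.sq_sqrt hQ
  have e3 := Real.sq_sqrt hR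
  have h1 : (σ * √P + τ * √Q) ^ 2 ≤ (σ + τ) * (σ * P + τ * Q) := by
    have := mul_nonneg (mul_nonneg hσ.le hτ.le) (sq_nonneg (√P - √Q))
    calc (σ * √P + τ * √Q) ^ 2 ≤ (σ + τ) * (σ * √P ^ 2 + τ * √Q ^ 2) := by linarith
      _ = _ := by rw [e1, e2]
  have h2 : σ * P + τ * Q ≤ (σ + τ) * R := by
    have : (σ + τ) * R - (σ * P + τ * Q) = σ * τ * (2 * ε - σ - τ) := by
      rw [hPd, hQd, hRd]; ring
    have h3 : 0 ≤ σ * τ * (2 * ε - σ - τ) := mul_nonneg (by positivity) (by linarith)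
    linarith
  calc (σ * √P + τ * √Q) ^ 2 ≤ (σ + τ) * (σ * P + τ * Q) := h1
    _ ≤ (σ + τ) * ((σ + τ) * R) := by gcongr
    _ = _ := by rw [mul_pow, e3]; ring

/-- One step of the growth estimate in the double-index recursion. -/
lemma growth_step {L σ τ a a₁ a₂ W W₁ W₂ E e G : ℝ} (hL : 0 ≤ L) (hσ : 0 < σ) (hτ : 0 < τ)
    (hLσ : 4 * L * σ ≤ 1) (hG : L * 4 * (σ + τ) ≤ G) (he : 0 ≤ e) (hW₁ : 0 ≤ W₁) (hW₂ : 0 ≤ W₂)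
    (h : (σ + τ) * a ≤ σ * a₁ + τ * a₂ + τ * σ * (2 * L * a + e))
    (h₁ : a₁ ≤ Real.exp (G - 4 * L * τ) * W₁) (h₂ : a₂ ≤ Real.exp (G - 4 * L * σ) * W₂)
    (hW : σ * W₁ + τ * W₂ + τ * σ * e ≤ (σ + τ) * W) (hE : E = Real.exp G) :
    a ≤ E * W := by
  -- The effective step once the recursion is divided by `σ + τ`; it is below both steps.
  set h' := τ * σ / (σ + τ) with hh
  have hst : 0 < σ + τ := by positivity
  have hh0 : 0 < h' := by positivity
  have hhτ : h' ≤ τ := by rw [hh, div_le_iff₀ hst]; nlinarith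
  have hhσ : h' ≤ σ := by rw [hh, div_le_iff₀ hst]; nlinarith
  have hmul : (σ + τ) * h' = τ * σ := by rw [hh]; field_simp
  have e1 : Real.exp (G - 4 * L * τ) ≤ Real.exp (G - 4 * L * h') := by gcongr
  have e2 : Real.exp (G - 4 * L * σ) ≤ Real.exp (G - 4 * L * h') := by gcongr
  have e3 : 1 ≤ Real.exp (G - 4 * L * h') := by
    rw [Real.one_le_exp_iff]; nlinarith
  have e4 : Real.exp (G - 4 * L * h') = E * Real.exp (-(4 * L * h')) := by
    rw [hE, ← Real.exp_add]; ring_nf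
  -- The rate `4L` in the exponential, twice the `2L` of the recursion, is what lets `1 - 2Lh'`
  -- absorb the implicit term.
  have e5 := exp_neg_le_one_sub_half (y := 4 * L * h') (by positivity) (by nlinarith)
  have hEpos : 0 < E := hE ▸ Real.exp_pos G
  set F := Real.exp (G - 4 * L * h') with hF
  have e6 : F ≤ E * (1 - 2 * L * h') := by rw [e4]; gcongr; linarith
  have g1 : a₁ ≤ F * W₁ := h₁.trans (by gcongr)
  have g2 : a₂ ≤ F * W₂ := h₂.trans (by gcongr)
  have hWnn : 0 ≤ W := by
    have : 0 ≤ (σ + τ) * W := le_trans (by positivity) hW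
    exact nonneg_of_mul_nonneg_right this hst
  have g3 : (σ + τ) * (a * (1 - 2 * L * h')) ≤ (σ + τ) * (F * W) := by
    calc (σ + τ) * (a * (1 - 2 * L * h')) = (σ + τ) * a - 2 * L * a * ((σ + τ) * h') := by ring
      _ = (σ + τ) * a - 2 * L * a * (τ * σ) := by rw [hmul]
      _ ≤ σ * a₁ + τ * a₂ + τ * σ * e := by linarith
      _ ≤ σ * (F * W₁) + τ * (F * W₂) + F * (τ * σ * e) := by
        have : τ * σ * e ≤ F * (τ * σ * e) := le_mul_of_one_le_left (by positivity) e3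
        gcongr
      _ = F * (σ * W₁ + τ * W₂ + τ * σ * e) := by ring
      _ ≤ F * ((σ + τ) * W) := by gcongr
      _ = _ := by ring
  have g4 : a * (1 - 2 * L * h') ≤ E * (1 - 2 * L * h') * W :=
    (le_of_mul_le_mul_left g3 hst).trans (by gcongr)
  have g5 : 0 < 1 - 2 * L * h' := by nlinarith
  exact le_of_mul_le_mul_right (by linarith) g5

/-- A double-index recursion as in the proof of the Crandall-Liggett theorem. -/
lemma double_index_estimate {t s U V e g : ℕ → ℝ} {a : ℕ → ℕ → ℝ} {L M ε : ℝ} {K J : ℕ}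
    (ht0 : t 0 = 0) (hs0 : s 0 = 0) (ht : StrictMono t) (hs : StrictMono s)
    (htε : ∀ k, t (k + 1) - t k ≤ ε) (hsε : ∀ k, s (k + 1) - s k ≤ ε)
    (hL : 0 ≤ L) (hLε : 4 * L * ε ≤ 1) (hM : 0 ≤ M) (he : ∀ k, 0 ≤ e k) (hg : ∀ k, 0 ≤ g k)
    (hU0 : 0 ≤ U 0) (hV0 : 0 ≤ V 0)
    (hU : ∀ k, U k + (t (k + 1) - t k) * e k ≤ U (k + 1))
    (hV : ∀ k, V k + (s (k + 1) - s k) * g k ≤ V (k + 1))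
    (hak : ∀ k ≤ K, a k 0 ≤ M * t k) (haj : ∀ j ≤ J, a 0 j ≤ M * s j)
    (ha : ∀ k j, ((s (j + 1) - s j) + (t (k + 1) - t k)) * a (k + 1) (j + 1) ≤
      (s (j + 1) - s j) * a k (j + 1) + (t (k + 1) - t k) * a (k + 1) j +
      (t (k + 1) - t k) * (s (j + 1) - s j) * (2 * L * a (k + 1) (j + 1) + (e k + g j))) :
    ∀ k ≤ K, ∀ j ≤ J, a k j ≤
      Real.exp (4 * L * (t k + s j)) * (M * √((t k - s j) ^ 2 + ε * (t k + s j)) + U k + V j) := by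
  have htn : ∀ k, 0 ≤ t k := fun k => ht0 ▸ ht.monotone (Nat.zero_le k)
  have hsn : ∀ k, 0 ≤ s k := fun k => hs0 ▸ hs.monotone (Nat.zero_le k)
  have hτ : ∀ k, 0 < t (k + 1) - t k := fun k => sub_pos.2 (ht (Nat.lt_succ_self k))
  have hσ : ∀ k, 0 < s (k + 1) - s k := fun k => sub_pos.2 (hs (Nat.lt_succ_self k))
  have hε : 0 ≤ ε := (hτ 0).le.trans (htε 0)
  have hUn : ∀ k, 0 ≤ U k := by
    intro k
    induction k with
    | zero => exact hU0
    | succ k ih => exact le_trans (add_nonneg ih (mul_nonneg (hτ k).le (he k))) (hU k)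
  have hVn : ∀ k, 0 ≤ V k := by
    intro k
    induction k with
    | zero => exact hV0
    | succ k ih => exact le_trans (add_nonneg ih (mul_nonneg (hσ k).le (hg k))) (hV k)
  have hexp : ∀ k j, 1 ≤ Real.exp (4 * L * (t k + s j)) := fun k j => by
    rw [Real.one_le_exp_iff]
    have := htn k; have := hsn j
    positivity
  -- On the axes `|t - s| = r`, so the root is at least `r` and dominates the linear boundary data.
  have hboundary : ∀ {r q u v E : ℝ}, 0 ≤ r → 1 ≤ E → 0 ≤ u → 0 ≤ v → r ^ 2 ≤ q →
      M * r ≤ E * (M * √q + u + v) := by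
    intro r q u v E hr hE hu hv hq
    have h1 : r ≤ √q := Real.le_sqrt_of_sq_le hq
    calc M * r ≤ M * √q := by gcongr
      _ ≤ 1 * (M * √q + u + v) := by linarith
      _ ≤ _ := by gcongr
  intro k
  induction k with
  | zero =>
    intro _ j hj
    refine (haj j hj).trans (hboundary (hsn j) (hexp 0 j) (hUn 0) (hVn j) ?_)
    have := mul_nonneg hε (hsn j)
    rw [ht0]; nlinarith
  | succ k ihk =>
    intro hk j
    induction j with
    | zero =>
      intro _
      refine (hak _ hk).trans (hboundary (htn _) (hexp _ 0) (hUn _) (hVn 0) ?_)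
      have := mul_nonneg hε (htn (k + 1))
      rw [hs0]; nlinarith
    | succ j ihj =>
      intro hj
      have i1 := ihk (by omega) (j + 1) hj
      have i2 := ihj (by omega)
      have hτk := hτ k
      have hσj := hσ j
      have etk : t k = t (k + 1) - (t (k + 1) - t k) := by ring
      have esj : s j = s (j + 1) - (s (j + 1) - s j) := by ring
      set τ := t (k + 1) - t k with hτd
      set σ := s (j + 1) - s j with hσd
      have hSt : σ + τ ≤ t (k + 1) + s (j + 1) := by have := htn k; have := hsn j; linarith
      have hkob := kobayashi_sqrt_step (D := t (k + 1) - s (j + 1)) hσj hτk (hsε j) (htε k) hSt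
      have r1 : (t (k + 1) - s (j + 1) - τ) ^ 2 + ε * (t (k + 1) + s (j + 1) - τ) =
          (t k - s (j + 1)) ^ 2 + ε * (t k + s (j + 1)) := by rw [etk]; ring
      have r2 : (t (k + 1) - s (j + 1) + σ) ^ 2 + ε * (t (k + 1) + s (j + 1) - σ) =
          (t (k + 1) - s j) ^ 2 + ε * (t (k + 1) + s j) := by rw [esj]; ring
      rw [r1, r2] at hkob
      have hUk := hU k
      have hVj := hV j
      have := hUn k; have := hUn (k + 1); have := hVn j; have := hVn (j + 1)
      refine growth_step hL hσj hτk ?_ ?_ (add_nonneg (he k) (hg j)) ?_ ?_ (ha k j)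
        (W₁ := M * √((t k - s (j + 1)) ^ 2 + ε * (t k + s (j + 1))) + U k + V (j + 1))
        (W₂ := M * √((t (k + 1) - s j) ^ 2 + ε * (t (k + 1) + s j)) + U (k + 1) + V j)
        ?_ ?_ ?_ rfl
      · exact le_trans (by gcongr; exact hsε j) hLε
      · nlinarith
      · positivity
      · positivity
      · refine i1.trans (le_of_eq ?_)
        congr 2; rw [hτd]; ring
      · refine i2.trans (le_of_eq ?_)
        congr 2; rw [hσd]; ring
      · have m1 := mul_le_mul_of_nonneg_left hkob hM
        have m2 := mul_le_mul_of_nonneg_left hUk hσj.le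
        have m3 := mul_le_mul_of_nonneg_left hVj hτk.le
        linarith

section Flow

variable {X : Type*} [MetricSpace X] {φ : X → EReal} {C L : ℝ}

/-- Take `σ` times the EVI of `x`, tested at `y (j+1)`, plus `τ` times that of `y`, tested at `x
(k+1)`: the potentials cancel. The functions `U`, `V` accumulate the curvature errors, which
telescope to `2Cε` times the drops. -/
lemma FlowSetting.exists_comparison (S : FlowSetting φ C L) {x₀ : X} (hx₀ : x₀ ∈ dom φ) (T : ℝ) :
    ∃ ε₀ > 0, ∃ M ≥ 0, ∀ ε ≤ ε₀, ∀ p x q y, IsPartition p → IsDiscreteSolution φ x₀ p x →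
      IsPartition q → IsDiscreteSolution φ x₀ q y →
      (∀ k, p (k + 1) - p k ≤ ε) → (∀ k, q (k + 1) - q k ≤ ε) → ∀ k j, p k ≤ T → q j ≤ T →
      dist (x k) (y j) ^ 2 ≤
        Real.exp (8 * L * T) * (M * √((p k - q j) ^ 2 + ε * (2 * T)) + 2 * C * ε * M) := by
  obtain ⟨ε₁, hε₁, M, hM, hdrop⟩ := S.exists_drop_bound hx₀ T
  have hC := S.C_nonneg
  have hL := S.L_nonneg
  -- The second bound ensures `4Lε ≤ 1`. The constant is `2M` because `d²(x₀, x k) ≤ 2 p k · M`,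
  -- which is the boundary datum of the recursion.
  refine ⟨min ε₁ (1 / (4 * (L + 1))), lt_min hε₁ (by positivity), 2 * M, by positivity, ?_⟩
  intro ε hε p x q y hp hx hq hy hpε hqε k j hk hj
  have hε1 : ε ≤ ε₁ := hε.trans (min_le_left _ _)
  have hε2 : 4 * L * ε ≤ 1 := by
    have h := hε.trans (min_le_right _ _)
    rw [le_div_iff₀ (by positivity)] at h
    have : 0 ≤ ε := (sub_pos.2 (hp.2.1 Nat.zero_lt_one)).le.trans (hpε 0)
    linarith
  have hε0 : 0 ≤ ε := (sub_pos.2 (hp.2.1 Nat.zero_lt_one)).le.trans (hpε 0)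
  have hpn : ∀ k, 0 ≤ p k := fun k => hp.1 ▸ hp.2.1.monotone (Nat.zero_le k)
  have hqn : ∀ k, 0 ≤ q k := fun k => hq.1 ▸ hq.2.1.monotone (Nat.zero_le k)
  have hT : 0 ≤ T := (hpn k).trans hk
  have hxd := hdrop p x hp hx (fun k => (hpε k).trans hε1)
  have hyd := hdrop q y hq hy (fun k => (hqε k).trans hε1)
  have hxa := hx.val_antitone S.bot hx₀ hp
  have hya := hy.val_antitone S.bot hx₀ hq
  have main := double_index_estimate (t := p) (s := q) (a := fun k j => dist (x k) (y j) ^ 2)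
    (U := fun k => 2 * C * ε * (val φ x₀ - val φ (x k)))
    (V := fun k => 2 * C * ε * (val φ x₀ - val φ (y k)))
    (e := fun k => 2 * C * (val φ (x k) - val φ (x (k + 1))))
    (g := fun k => 2 * C * (val φ (y k) - val φ (y (k + 1))))
    (L := L) (M := 2 * M) (ε := ε) (K := k) (J := j)
    hp.1 hq.1 hp.2.1 hq.2.1 hpε hqε hL hε2 (by positivity)
    (fun k => mul_nonneg (by positivity) (sub_nonneg.2 (hxa (Nat.le_succ k))))
    (fun k => mul_nonneg (by positivity) (sub_nonneg.2 (hya (Nat.le_succ k))))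
    (by simp [hx.1]) (by simp [hy.1])
    (fun k => by
      have h1 := mul_nonneg (mul_nonneg hC (sub_nonneg.2 (hxa (Nat.le_succ k))))
        (sub_nonneg.2 (hpε k))
      simp only at h1
      linarith)
    (fun k => by
      have h1 := mul_nonneg (mul_nonneg hC (sub_nonneg.2 (hya (Nat.le_succ k))))
        (sub_nonneg.2 (hqε k))
      simp only at h1
      linarith)
    (fun i hi => by
      have h1 := hx.sq_dist_le S.bot hx₀ hp (Nat.zero_le i)
      have h2 := hxd i ((hp.2.1.monotone hi).trans hk)
      rw [hp.1, hx.1, sub_zero] at h1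
      have h3 := mul_le_mul_of_nonneg_left h2 (hpn i)
      simp only [hy.1, dist_comm (x i)]
      linarith)
    (fun i hi => by
      have h1 := hy.sq_dist_le S.bot hx₀ hq (Nat.zero_le i)
      have h2 := hyd i ((hq.2.1.monotone hi).trans hj)
      rw [hq.1, hy.1, sub_zero] at h1
      have h3 := mul_le_mul_of_nonneg_left h2 (hqn i)
      simp only [hx.1]
      linarith)
    (fun k j => by
      have h1 := hx.evi S hx₀ hp k (hy.mem_dom S.bot hx₀ (j + 1))
      have h2 := hy.evi S hx₀ hq j (hx.mem_dom S.bot hx₀ (k + 1))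
      rw [dist_comm (y (j + 1)), dist_comm (y j)] at h2
      have h3 := mul_le_mul_of_nonneg_left h1 (sub_pos.2 (hq.2.1 (Nat.lt_succ_self j))).le
      have h4 := mul_le_mul_of_nonneg_left h2 (sub_pos.2 (hp.2.1 (Nat.lt_succ_self k))).le
      linarith) k le_rfl j le_rfl
  refine main.trans ?_
  have e1 : 4 * L * (p k + q j) ≤ 8 * L * T := by nlinarith
  have e2 : ε * (p k + q j) ≤ ε * (2 * T) := by gcongr; linarith
  have e3 := mul_le_mul_of_nonneg_left (hxd k hk) (by positivity : 0 ≤ 2 * C * ε)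
  have e4 := mul_le_mul_of_nonneg_left (hyd j hj) (by positivity : 0 ≤ 2 * C * ε)
  have e5 : 0 ≤ √((p k - q j) ^ 2 + ε * (2 * T)) := Real.sqrt_nonneg _
  calc _ ≤ Real.exp (4 * L * (p k + q j)) *
        (2 * M * √((p k - q j) ^ 2 + ε * (2 * T)) + 2 * C * ε * (2 * M)) := by
        have e6 : √((p k - q j) ^ 2 + ε * (p k + q j)) ≤ √((p k - q j) ^ 2 + ε * (2 * T)) := by
          gcongr
        have e7 := mul_le_mul_of_nonneg_left e6 (by positivity : 0 ≤ 2 * M)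
        gcongr _ * ?_
        linarith
    _ ≤ _ := by gcongr

/-! ### Interpolations -/

/-- The index of the node selected by the interpolation. -/
noncomputable def nodeIndex (p : ℕ → ℝ) (t : ℝ≥0) : ℕ := sInf {k : ℕ | (t : ℝ) ≤ p k}

lemma interpolate_eq {Y : Type*} (p : ℕ → ℝ) (x : ℕ → Y) (t : ℝ≥0) :
    interpolate p x t = x (nodeIndex p t) := rfl

lemma IsPartition.le_node {p : ℕ → ℝ} (hp : IsPartition p) (t : ℝ≥0) :
    (t : ℝ) ≤ p (nodeIndex p t) := by
  have hne : {k : ℕ | (t : ℝ) ≤ p k}.Nonempty :=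
    (hp.2.2.eventually (eventually_ge_atTop (t : ℝ))).exists
  exact Nat.sInf_mem hne

lemma IsPartition.node_le {p : ℕ → ℝ} (hp : IsPartition p) {ε : ℝ} (hε : ∀ k, p (k + 1) - p k ≤ ε)
    (t : ℝ≥0) : p (nodeIndex p t) ≤ t + ε := by
  have hε0 : 0 ≤ ε := (sub_pos.2 (hp.2.1 Nat.zero_lt_one)).le.trans (hε 0)
  rcases h : nodeIndex p t with _ | k
  · rw [hp.1]; positivity
  · have hk : k ∉ {k : ℕ | (t : ℝ) ≤ p k} := by
      apply Nat.notMem_of_lt_sInf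
      change k < nodeIndex p t
      omega
    have hk' : p k < t := not_le.1 hk
    have := hε k
    linarith

lemma nodeIndex_mono {p : ℕ → ℝ} (hp : IsPartition p) {s t : ℝ≥0} (h : s ≤ t) :
    nodeIndex p s ≤ nodeIndex p t :=
  Nat.sInf_le ((NNReal.coe_le_coe.2 h).trans (hp.le_node t))

lemma nodeIndex_zero {p : ℕ → ℝ} (hp : IsPartition p) : nodeIndex p 0 = 0 :=
  Nat.sInf_eq_zero.2 (Or.inl (by simp [hp.1]))

lemma exists_real_mesh {p : ℕ → ℕ → ℝ} (h : Tendsto (fun i => mesh (p i)) atTop (𝓝 0)) :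
    ∃ ε : ℕ → ℝ, Tendsto ε atTop (𝓝 0) ∧ ∀ᶠ i in atTop, ∀ k, p i (k + 1) - p i k ≤ ε i := by
  refine ⟨fun i => (mesh (p i)).toReal, ?_, ?_⟩
  · simpa [Function.comp_def] using (ENNReal.tendsto_toReal ENNReal.zero_ne_top).comp h
  · filter_upwards [h.eventually (gt_mem_nhds ENNReal.zero_lt_top)] with i hi k
    exact (ENNReal.ofReal_le_iff_le_toReal hi.ne).1
      (le_iSup (fun k => ENNReal.ofReal (p i (k + 1) - p i k)) k)

lemma tendsto_node {p : ℕ → ℕ → ℝ} (hp : ∀ i, IsPartition (p i)) {ε : ℕ → ℝ}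
    (hε : Tendsto ε atTop (𝓝 0)) (h : ∀ᶠ i in atTop, ∀ k, p i (k + 1) - p i k ≤ ε i) (t : ℝ≥0) :
    Tendsto (fun i => p i (nodeIndex (p i) t)) atTop (𝓝 t) := by
  refine tendsto_of_tendsto_of_tendsto_of_le_of_le' tendsto_const_nhds
    (h := fun i => t + ε i) ?_ (Eventually.of_forall fun i => (hp i).le_node t) ?_
  · simpa using tendsto_const_nhds.add hε
  · filter_upwards [h] with i hi using (hp i).node_le hi t

/-- Stated for a general filter to serve twice: over `ℕ` for uniqueness of the limit, over `ℕ × ℕ`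
for the Cauchy property. -/
lemma FlowSetting.tendsto_dist_interpolate (S : FlowSetting φ C L) {x₀ : X} (hx₀ : x₀ ∈ dom φ)
    {ι : Type*} {l : Filter ι} {p q : ι → ℕ → ℝ} {x y : ι → ℕ → X} {ε : ι → ℝ}
    (hp : ∀ i, IsPartition (p i)) (hq : ∀ i, IsPartition (q i))
    (hx : ∀ i, IsDiscreteSolution φ x₀ (p i) (x i)) (hy : ∀ i, IsDiscreteSolution φ x₀ (q i) (y i))
    (hε : Tendsto ε l (𝓝 0)) (hpε : ∀ᶠ i in l, ∀ k, p i (k + 1) - p i k ≤ ε i)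
    (hqε : ∀ᶠ i in l, ∀ k, q i (k + 1) - q i k ≤ ε i) (t : ℝ≥0) :
    Tendsto (fun i => dist (interpolate (p i) (x i) t) (interpolate (q i) (y i) t)) l (𝓝 0) := by
  -- The horizon is `t + 1` since the selected nodes overshoot `t` by at most the mesh.
  obtain ⟨ε₀, hε₀, M, hM, h⟩ := S.exists_comparison hx₀ (t + 1)
  have hC := S.C_nonneg
  set ω : ℝ → ℝ := fun ε => Real.exp (8 * L * (t + 1)) *
    (M * √(ε ^ 2 + ε * (2 * (t + 1))) + 2 * C * ε * M) with hω
  have hω0 : Tendsto (fun i => √(ω (ε i))) l (𝓝 0) := by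
    have hcont : Continuous fun e => √(ω e) := by rw [hω]; fun_prop
    have := (hcont.tendsto 0).comp hε
    simpa [hω, Function.comp_def] using this
  refine squeeze_zero' (Eventually.of_forall fun _ => dist_nonneg) ?_ hω0
  filter_upwards [hpε, hqε, hε.eventually (gt_mem_nhds hε₀),
    hε.eventually (gt_mem_nhds zero_lt_one)] with i h1 h2 h3 h4
  refine Real.le_sqrt_of_sq_le ?_
  have a1 := (hp i).le_node t
  have a2 := (hp i).node_le h1 t
  have a3 := (hq i).le_node t
  have a4 := (hq i).node_le h2 t
  refine (h (ε i) h3.le _ _ _ _ (hp i) (hx i) (hq i) (hy i) h1 h2 (nodeIndex (p i) t)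
    (nodeIndex (q i) t) (by linarith) (by linarith)).trans ?_
  have a5 : (p i (nodeIndex (p i) t) - q i (nodeIndex (q i) t)) ^ 2 ≤ ε i ^ 2 :=
    sq_le_sq' (by linarith) (by linarith)
  simp only [hω]
  gcongr

/-! ### Uniqueness and existence of gradient curves -/

lemma FlowSetting.gradientCurve_unique (S : FlowSetting φ C L) {x₀ : X} (hx₀ : x₀ ∈ dom φ)
    {ξ ζ : ℝ≥0 → X} (hξ : IsGradientCurve φ x₀ ξ) (hζ : IsGradientCurve φ x₀ ζ) : ξ = ζ := by
  obtain ⟨p, x, hp, hpm, hx, hxξ⟩ := hξ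
  obtain ⟨q, y, hq, hqm, hy, hyζ⟩ := hζ
  obtain ⟨ε, hε, hpε⟩ := exists_real_mesh hpm
  obtain ⟨δ, hδ, hqδ⟩ := exists_real_mesh hqm
  funext t
  have hmax : Tendsto (fun i => max (ε i) (δ i)) atTop (𝓝 0) := by simpa using hε.max hδ
  have h := S.tendsto_dist_interpolate hx₀ hp hq hx hy hmax
    (hpε.mono fun i hi k => (hi k).trans (le_max_left _ _))
    (hqδ.mono fun i hi k => (hi k).trans (le_max_right _ _)) t
  exact dist_eq_zero.1 (tendsto_nhds_unique ((hxξ t).dist (hyζ t)) h)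

lemma FlowSetting.exists_discreteSolution (S : FlowSetting φ C L) {x₀ : X} (hx₀ : x₀ ∈ dom φ)
    {τs : ℝ} (hτs : ∀ x ∈ dom φ, ∀ τ, 0 < τ → τ < τs → (proxSet φ τ x).Nonempty)
    {p : ℕ → ℝ} (hp : IsPartition p) (hpτ : ∀ k, p (k + 1) - p k < τs) :
    ∃ x, IsDiscreteSolution φ x₀ p x := by
  choose! J hJ using hτs
  let x : ℕ → X := fun n => Nat.rec x₀ (fun k z => J z (p (k + 1) - p k)) n
  have hτ : ∀ k, 0 < p (k + 1) - p k := fun k => sub_pos.2 (hp.2.1 (Nat.lt_succ_self k))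
  have hxd : ∀ n, x n ∈ dom φ := by
    intro n
    induction n with
    | zero => exact hx₀
    | succ k ih => exact (prox_spec S.bot ih (hJ _ ih _ (hτ k) (hpτ k))).1
  exact ⟨x, rfl, fun k => hJ _ (hxd k) _ (hτ k) (hpτ k)⟩

lemma isPartition_uniform {h : ℝ} (hh : 0 < h) : IsPartition fun k : ℕ => k * h := by
  refine ⟨by simp, fun a b hab => ?_, tendsto_natCast_atTop_atTop.atTop_mul_const hh⟩
  have : (a : ℝ) < b := by exact_mod_cast hab
  simp only
  gcongr

lemma FlowSetting.exists_gradientCurve [CompleteSpace X] (S : FlowSetting φ C L) {x₀ : X}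
    (hx₀ : x₀ ∈ dom φ) : ∃ ξ, IsGradientCurve φ x₀ ξ := by
  obtain ⟨τs, hτs, hprox⟩ := S.prox
  obtain ⟨h, hhpos, hhlt, hh0⟩ : ∃ h : ℕ → ℝ, (∀ i, 0 < h i) ∧ (∀ i, h i < τs) ∧
      Tendsto h atTop (𝓝 0) := by
    refine ⟨fun i => τs / (i + 2), fun i => by positivity, fun i => ?_, ?_⟩
    · rw [div_lt_iff₀ (by positivity)]
      nlinarith [(Nat.cast_nonneg i : (0 : ℝ) ≤ i)]
    · exact Tendsto.div_atTop tendsto_const_nhds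
        (tendsto_atTop_add_const_right _ _ tendsto_natCast_atTop_atTop)
  obtain ⟨p, hp, hstep⟩ : ∃ p : ℕ → ℕ → ℝ, (∀ i, IsPartition (p i)) ∧
      ∀ i k, p i (k + 1) - p i k = h i :=
    ⟨fun i k => k * h i, fun i => isPartition_uniform (hhpos i), fun i k => by push_cast; ring⟩
  have hex : ∀ i, ∃ x, IsDiscreteSolution φ x₀ (p i) x := fun i =>
    S.exists_discreteSolution hx₀ hprox (hp i) fun k => by rw [hstep]; exact hhlt i
  choose x hx using hex
  have hcau : ∀ t, CauchySeq fun i => interpolate (p i) (x i) t := by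
    intro t
    rw [cauchySeq_iff_tendsto_dist_atTop_0]
    have hmax : Tendsto (fun n : ℕ × ℕ => max (h n.1) (h n.2)) atTop (𝓝 0) := by
      rw [← prod_atTop_atTop_eq]
      simpa using (hh0.comp tendsto_fst).max (hh0.comp tendsto_snd)
    exact S.tendsto_dist_interpolate hx₀ (p := fun n : ℕ × ℕ => p n.1)
      (q := fun n : ℕ × ℕ => p n.2) (x := fun n => x n.1) (y := fun n => x n.2)
      (ε := fun n => max (h n.1) (h n.2)) (fun n => hp n.1) (fun n => hp n.2) (fun n => hx n.1)
      (fun n => hx n.2) hmax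
      (Eventually.of_forall fun n k => (hstep n.1 k).le.trans (le_max_left _ _))
      (Eventually.of_forall fun n k => (hstep n.2 k).le.trans (le_max_right _ _)) t
  choose ξ hξ using fun t => cauchySeq_tendsto_of_complete (hcau t)
  refine ⟨ξ, p, x, hp, ?_, hx, hξ⟩
  have : ∀ i, mesh (p i) = ENNReal.ofReal (h i) := fun i => by
    simp only [mesh, hstep, ciSup_const]
  simp only [this]
  simpa using ENNReal.tendsto_ofReal hh0

lemma FlowSetting.existsUnique_gradientCurve [CompleteSpace X] (S : FlowSetting φ C L) {x₀ : X}
    (hx₀ : x₀ ∈ dom φ) : ∃! ξ, IsGradientCurve φ x₀ ξ := by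
  obtain ⟨ξ, hξ⟩ := S.exists_gradientCurve hx₀
  exact ⟨ξ, hξ, fun ζ hζ => S.gradientCurve_unique hx₀ hζ hξ⟩

/-! ### Properties of gradient curves -/

lemma IsGradientCurve.apply_zero {x₀ : X} {ξ : ℝ≥0 → X} (hξ : IsGradientCurve φ x₀ ξ) :
    ξ 0 = x₀ := by
  obtain ⟨p, x, hp, -, hx, hxξ⟩ := hξ
  refine tendsto_nhds_unique (hxξ 0) ?_
  simp [interpolate_eq, nodeIndex_zero (hp _), (hx _).1]

/-- The discrete energy inequality, solved for `φ (x k)`, has a right side that converges, so lower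
semicontinuity passes it to the limit. -/
lemma IsGradientCurve.energy {x₀ : X} {ξ : ℝ≥0 → X} (hξ : IsGradientCurve φ x₀ ξ)
    (hbot : ∀ x, φ x ≠ ⊥) (hlsc : LowerSemicontinuous φ) (hx₀ : x₀ ∈ dom φ) (t : ℝ≥0) :
    ξ t ∈ dom φ ∧ val φ (ξ t) ≤ val φ x₀ ∧
      dist x₀ (ξ t) ^ 2 ≤ 2 * t * (val φ x₀ - val φ (ξ t)) := by
  rcases eq_or_lt_of_le (zero_le : 0 ≤ t) with rfl | ht
  · rw [hξ.apply_zero]; simp [hx₀]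
  obtain ⟨p, x, hp, hpm, hx, hxξ⟩ := hξ
  obtain ⟨ε, hε, hpε⟩ := exists_real_mesh hpm
  have hnode := tendsto_node hp hε hpε t
  have ht' : (0 : ℝ) < t := ht
  have h := mem_dom_and_val_le_of_tendsto hbot hlsc (hxξ t)
    (b := fun i => val φ x₀ -
      dist x₀ (interpolate (p i) (x i) t) ^ 2 / (2 * p i (nodeIndex (p i) t)))
    (c := val φ x₀ - dist x₀ (ξ t) ^ 2 / (2 * t))
    (Eventually.of_forall fun i => (hx i).mem_dom hbot hx₀ _)
    (Eventually.of_forall fun i => by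
      have h1 := (hx i).sq_dist_le hbot hx₀ (hp i) (Nat.zero_le (nodeIndex (p i) t))
      have h2 : 0 < p i (nodeIndex (p i) t) := ht'.trans_le ((hp i).le_node t)
      rw [(hp i).1, (hx i).1, sub_zero, ← interpolate_eq (p i) (x i) t] at h1
      have h3 : dist x₀ (interpolate (p i) (x i) t) ^ 2 / (2 * p i (nodeIndex (p i) t)) ≤
          val φ x₀ - val φ (interpolate (p i) (x i) t) := by
        rw [div_le_iff₀ (by positivity)]; linarith
      linarith)
    (tendsto_const_nhds.sub (((tendsto_const_nhds.dist (hxξ t)).pow 2).div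
      (hnode.const_mul 2) (by positivity)))
  have h4 : 0 ≤ dist x₀ (ξ t) ^ 2 / (2 * (t : ℝ)) := by positivity
  refine ⟨h.1, by linarith [h.2], ?_⟩
  have h5 : dist x₀ (ξ t) ^ 2 / (2 * (t : ℝ)) ≤ val φ x₀ - val φ (ξ t) := by linarith [h.2]
  rw [div_le_iff₀ (by positivity)] at h5
  linarith

/-- The drop bound makes discrete solutions, up to the mesh, locally 1/2-Hölder uniformly in the
partition. -/
lemma FlowSetting.continuous_gradientCurve (S : FlowSetting φ C L) {x₀ : X} (hx₀ : x₀ ∈ dom φ)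
    {ξ : ℝ≥0 → X} (hξ : IsGradientCurve φ x₀ ξ) : Continuous ξ := by
  obtain ⟨p, x, hp, hpm, hx, hxξ⟩ := hξ
  obtain ⟨ε, hε, hpε⟩ := exists_real_mesh hpm
  have hnode := tendsto_node hp hε hpε
  rw [continuous_iff_continuousAt]
  intro t
  obtain ⟨ε₀, hε₀, M, hM, hdrop⟩ := S.exists_drop_bound hx₀ (t + 2)
  have key : ∀ r s : ℝ≥0, r ≤ s → (s : ℝ) ≤ t + 1 →
      dist (ξ r) (ξ s) ^ 2 ≤ 2 * (s - r) * M := by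
    intro r s hrs hs
    refine le_of_tendsto_of_tendsto (((hxξ r).dist (hxξ s)).pow 2)
      ((((hnode s).sub (hnode r)).const_mul 2).mul_const M) ?_
    filter_upwards [hpε, hε.eventually (gt_mem_nhds hε₀),
      hε.eventually (gt_mem_nhds zero_lt_one)] with i h1 h2 h3
    have hidx := nodeIndex_mono (hp i) hrs
    have h4 := (hx i).sq_dist_le S.bot hx₀ (hp i) hidx
    have h5 := hdrop _ _ (hp i) (hx i) (fun k => (h1 k).trans h2.le) (nodeIndex (p i) s)
      (by have := (hp i).node_le h1 s; linarith)
    have h6 := (hx i).val_le S.bot hx₀ (hp i) (nodeIndex (p i) r)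
    have h7 := (hp i).2.1.monotone hidx
    refine h4.trans ?_
    have : 0 ≤ p i (nodeIndex (p i) s) - p i (nodeIndex (p i) r) := sub_nonneg.2 h7
    gcongr
    linarith
  have hbound : ∀ s : ℝ≥0, (s : ℝ) ≤ t + 1 → dist (ξ s) (ξ t) ≤ √(2 * dist s t * M) := by
    intro s hs
    refine Real.le_sqrt_of_sq_le ?_
    rw [NNReal.dist_eq]
    rcases le_total s t with h | h
    · have := key s t h (by linarith)
      rwa [abs_sub_comm, abs_of_nonneg (sub_nonneg.2 (NNReal.coe_le_coe.2 h))]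
    · have := key t s h hs
      rwa [abs_of_nonneg (sub_nonneg.2 (NNReal.coe_le_coe.2 h)), dist_comm]
  rw [ContinuousAt, tendsto_iff_dist_tendsto_zero]
  have hlim : Tendsto (fun s : ℝ≥0 => √(2 * dist s t * M)) (𝓝 t) (𝓝 0) := by
    have : Continuous fun s : ℝ≥0 => √(2 * dist s t * M) := by fun_prop
    simpa using this.tendsto t
  refine squeeze_zero' (Eventually.of_forall fun _ => dist_nonneg) ?_ hlim
  have hlt : ∀ᶠ s : ℝ≥0 in 𝓝 t, s < t + 1 := gt_mem_nhds (lt_add_one t)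
  filter_upwards [hlt] with s hs
  exact hbound s (by exact_mod_cast hs.le)

end Flow

/-! ### Stationary points and the local slope -/

section Stationary

variable {X : Type*} [MetricSpace X] {φ : X → EReal} {C L : ℝ}

/-- Summed EVI, with every `φ (x k)` in the potential difference replaced by the smallest one, `φ (x
n)`. -/
lemma IsDiscreteSolution.sq_dist_le_sum {x₀ : X} {p : ℕ → ℝ} {x : ℕ → X}
    (hx : IsDiscreteSolution φ x₀ p x) (S : FlowSetting φ C L) (hx₀ : x₀ ∈ dom φ)
    (hp : IsPartition p) {y : X} (hy : y ∈ dom φ) {ε Q : ℝ} (hε : ∀ k, p (k + 1) - p k ≤ ε) (n : ℕ)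
    (hQ : ∀ k ≤ n, dist (x k) y ^ 2 ≤ Q) :
    dist (x n) y ^ 2 ≤ dist x₀ y ^ 2 + 2 * C * ε * (val φ x₀ - val φ (x n))
      + p n * (2 * (val φ y - val φ (x n)) + L * Q) := by
  have key : ∀ k ≤ n, dist (x k) y ^ 2 ≤ dist x₀ y ^ 2 + 2 * C * ε * (val φ x₀ - val φ (x k))
      + p k * (2 * (val φ y - val φ (x n)) + L * Q) := by
    intro k
    induction k with
    | zero => intro _; simp [hx.1, hp.1]
    | succ k ih =>
      intro hk
      have h1 := ih (by omega)
      have h2 := hx.evi S hx₀ hp k hy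
      have h3 := sub_nonneg.2 (hx.val_antitone S.bot hx₀ hp (Nat.le_succ k))
      have h4 := sub_nonneg.2 (hx.val_antitone S.bot hx₀ hp hk)
      have h5 := sub_nonneg.2 (hε k)
      have h6 : 0 ≤ p (k + 1) - p k := (sub_pos.2 (hp.2.1 (Nat.lt_succ_self k))).le
      have h7 := mul_nonneg (mul_nonneg S.C_nonneg h5) h3
      have h8 := mul_nonneg h6 h4
      have h9 := mul_nonneg (mul_nonneg h6 S.L_nonneg) (sub_nonneg.2 (hQ (k + 1) hk))
      simp only at h3 h4 h7 h8
      linarith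
  exact key n le_rfl

/-- Dividing the summed EVI by twice the time, the distances to `y` cancel in the limit of the
scheme because the curve has not moved. Letting `t → 0` then removes the displacement in `Q`. -/
lemma FlowSetting.val_sub_le_of_stationary (S : FlowSetting φ C L) {x₀ : X} (hx₀ : x₀ ∈ dom φ)
    {ξ : ℝ≥0 → X} (hξ : IsGradientCurve φ x₀ ξ) (hconst : ∀ t, 0 < t → ξ t = x₀) {y : X}
    (hy : y ∈ dom φ) : val φ x₀ - val φ y ≤ L / 2 * dist x₀ y ^ 2 := by
  obtain ⟨p, x, hp, hpm, hx, hxξ⟩ := hξ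
  obtain ⟨ε, hε, hpε⟩ := exists_real_mesh hpm
  have hnode := tendsto_node hp hε hpε
  obtain ⟨ε₀, hε₀, M, hM, hdrop⟩ := S.exists_drop_bound hx₀ 1
  have hL := S.L_nonneg
  have hC := S.C_nonneg
  -- With mesh below `t` the nodes used are at most `2t`, so `d² ≤ 2 · 2t · M` on the way; `t < 1/2`
  -- keeps them within the horizon 1.
  have key : ∀ t : ℝ≥0, 0 < t → (t : ℝ) < 1 / 2 →
      val φ x₀ ≤ val φ y + L / 2 * (dist x₀ y + √(4 * t * M)) ^ 2 := by
    intro t ht ht2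
    have ht' : (0 : ℝ) < t := ht
    set Q := (dist x₀ y + √(4 * t * M)) ^ 2 with hQ
    have hlim := hxξ t
    rw [hconst t ht] at hlim
    have hb : Tendsto (fun i => val φ y + L / 2 * Q + (dist x₀ y ^ 2 -
        dist (interpolate (p i) (x i) t) y ^ 2 + 2 * C * ε i * M) /
        (2 * p i (nodeIndex (p i) t))) atTop (𝓝 (val φ y + L / 2 * Q +
          (dist x₀ y ^ 2 - dist x₀ y ^ 2 + 2 * C * 0 * M) / (2 * t))) := by
      refine tendsto_const_nhds.add (Tendsto.div (Tendsto.add (tendsto_const_nhds.sub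
        ((hlim.dist tendsto_const_nhds).pow 2)) ((hε.const_mul _).mul_const M))
        ((hnode t).const_mul 2) (by positivity))
    have h := mem_dom_and_val_le_of_tendsto S.bot S.lsc hlim
      (Eventually.of_forall fun i => (hx i).mem_dom S.bot hx₀ _) ?_ hb
    · simpa using h.2
    filter_upwards [hpε, hε.eventually (gt_mem_nhds hε₀),
      hε.eventually (gt_mem_nhds ht')] with i h1 h2 h3
    set n := nodeIndex (p i) t with hn
    have h4 := (hp i).node_le h1 t
    have h5 := (hp i).le_node t
    rw [← hn] at h4 h5
    have hdr : ∀ k ≤ n, val φ x₀ - val φ (x i k) ≤ M := fun k hk =>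
      hdrop _ _ (hp i) (hx i) (fun k => (h1 k).trans h2.le) k
        (((hp i).2.1.monotone hk).trans (by linarith))
    have hεn : 0 ≤ ε i := (sub_pos.2 ((hp i).2.1 Nat.zero_lt_one)).le.trans (h1 0)
    have h6 := (hx i).sq_dist_le_sum S hx₀ (hp i) hy h1 n (Q := Q) (fun k hk => by
      have g1 := (hx i).sq_dist_le S.bot hx₀ (hp i) (Nat.zero_le k)
      rw [(hp i).1, (hx i).1, sub_zero] at g1
      have g2 : dist x₀ (x i k) ≤ √(4 * t * M) := by
        refine Real.le_sqrt_of_sq_le (g1.trans ?_)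
        have g3 : p i k ≤ 2 * t := ((hp i).2.1.monotone hk).trans (by linarith)
        have g4 : 0 ≤ p i k := (hp i).1 ▸ (hp i).2.1.monotone (Nat.zero_le k)
        calc 2 * p i k * (val φ x₀ - val φ (x i k)) ≤ 2 * p i k * M := by
              gcongr; exact hdr k hk
          _ ≤ 2 * (2 * t) * M := by gcongr
          _ = _ := by ring
      have g5 := dist_triangle (x i k) x₀ y
      rw [dist_comm (x i k) x₀] at g5
      rw [hQ]
      gcongr
      linarith)
    have h7 : 0 < p i n := ht'.trans_le h5
    have h8 : 2 * C * ε i * (val φ x₀ - val φ (x i n)) ≤ 2 * C * ε i * M := by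
      gcongr; exact hdr n le_rfl
    change val φ (x i n) ≤ val φ y + L / 2 * Q +
      (dist x₀ y ^ 2 - dist (x i n) y ^ 2 + 2 * C * ε i * M) / (2 * p i n)
    have h9 : val φ (x i n) - val φ y - L / 2 * Q ≤
        (dist x₀ y ^ 2 - dist (x i n) y ^ 2 + 2 * C * ε i * M) / (2 * p i n) := by
      rw [le_div_iff₀ (by positivity)]
      linarith
    linarith
  have hlim : Tendsto (fun t : ℝ≥0 => val φ y + L / 2 * (dist x₀ y + √(4 * t * M)) ^ 2)
      (𝓝[>] 0) (𝓝 (val φ y + L / 2 * dist x₀ y ^ 2)) := by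
    have : Continuous fun t : ℝ≥0 => val φ y + L / 2 * (dist x₀ y + √(4 * t * M)) ^ 2 := by
      fun_prop
    have h := (this.tendsto 0).mono_left (nhdsWithin_le_nhds (s := Ioi 0))
    simpa using h
  have hev : ∀ᶠ t : ℝ≥0 in 𝓝[>] 0,
      val φ x₀ ≤ val φ y + L / 2 * (dist x₀ y + √(4 * t * M)) ^ 2 := by
    have h1 : ∀ᶠ t : ℝ≥0 in 𝓝 0, t < 1 / 2 := gt_mem_nhds (by norm_num)
    filter_upwards [self_mem_nhdsWithin, nhdsWithin_le_nhds h1] with t ht ht2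
    refine key t ht ?_
    have : ((t : ℝ≥0) : ℝ) < ((1 / 2 : ℝ≥0) : ℝ) := NNReal.coe_lt_coe.2 ht2
    simpa using this
  have := ge_of_tendsto hlim hev
  linarith

lemma slope_quotient_eq (hbot : ∀ x, φ x ≠ ⊥) {x y : X} (hx : x ∈ dom φ) (hy : y ∈ dom φ)
    (hpos : 0 < dist x y) : (max (φ x - φ y) 0).toENNReal / edist x y =
      ENNReal.ofReal (max (val φ x - val φ y) 0 / dist x y) := by
  have h : max (φ x - φ y) 0 = ((max (val φ x - val φ y) 0 : ℝ) : EReal) := by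
    rw [EReal.coe_strictMono.monotone.map_max, EReal.coe_sub, coe_val hbot hx, coe_val hbot hy,
      EReal.coe_zero]
  rw [h, EReal.toENNReal_of_ne_top (EReal.coe_ne_top _), EReal.toReal_coe, edist_dist,
    ENNReal.ofReal_div_of_pos hpos]

lemma localSlope_eq_zero_of_val_sub_le (hbot : ∀ x, φ x ≠ ⊥) {x₀ : X} (hx₀ : x₀ ∈ dom φ) {c : ℝ}
    (h : ∀ y ∈ dom φ, val φ x₀ - val φ y ≤ c * dist x₀ y ^ 2) : localSlope φ x₀ = 0 := by
  have hbound : ∀ᶠ y in 𝓝[≠] x₀, (max (φ x₀ - φ y) 0).toENNReal / edist x₀ y ≤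
      ENNReal.ofReal (|c| * dist x₀ y) := by
    filter_upwards [self_mem_nhdsWithin] with y hy
    have hpos : 0 < dist x₀ y := dist_pos.2 (Ne.symm hy)
    by_cases hyd : y ∈ dom φ
    · rw [slope_quotient_eq hbot hx₀ hyd hpos]
      refine ENNReal.ofReal_le_ofReal ?_
      rw [div_le_iff₀ hpos]
      have h1 := h y hyd
      have h2 := mul_le_mul_of_nonneg_right (le_abs_self c) (sq_nonneg (dist x₀ y))
      have h3 : 0 ≤ |c| * dist x₀ y ^ 2 := by positivity
      exact max_le (by linarith) (by linarith)
    · have : φ y = ⊤ := by simpa [dom] using hyd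
      rw [this, EReal.sub_top]
      simp
  have hlim : Tendsto (fun y => ENNReal.ofReal (|c| * dist x₀ y)) (𝓝[≠] x₀) (𝓝 0) := by
    have : Continuous fun y => ENNReal.ofReal (|c| * dist x₀ y) :=
      ENNReal.continuous_ofReal.comp (by fun_prop)
    have h1 := (this.tendsto x₀).mono_left (nhdsWithin_le_nhds (s := {x₀}ᶜ))
    simpa using h1
  rcases eq_or_neBot (𝓝[≠] x₀) with hb | hb
  · simp [localSlope, hb]
  · refine le_antisymm ?_ zero_le
    calc localSlope φ x₀ ≤ limsup (fun y => ENNReal.ofReal (|c| * dist x₀ y)) (𝓝[≠] x₀) :=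
          limsup_le_limsup hbound
      _ = 0 := hlim.limsup_eq

/-- Semiconvexity makes the slope global: the convexity inequality at `γ s`, divided by `s`,
compares the secant to `y` with difference quotients at `x₀`, which tend to 0. -/
lemma val_sub_le_of_localSlope_eq_zero (hbot : ∀ x, φ x ≠ ⊥) {lam : ℝ}
    (hconv : IsLambdaConvex φ lam) {x₀ : X} (hx₀ : x₀ ∈ dom φ) (h : localSlope φ x₀ = 0)
    {y : X} (hy : y ∈ dom φ) : val φ x₀ - val φ y ≤ -(lam / 2) * dist x₀ y ^ 2 := by
  rcases eq_or_ne x₀ y with rfl | hne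
  · simp
  have hpos : 0 < dist x₀ y := dist_pos.2 hne
  obtain ⟨γ, hγ, hγc⟩ := hconv x₀ hx₀ y hy
  have hdist : ∀ s ∈ Icc (0 : ℝ) 1, dist x₀ (γ s) = s * dist x₀ y := fun s hs => by
    have := hγ.2.2 0 (by simp) s hs
    rw [hγ.1, zero_sub, abs_neg, abs_of_nonneg hs.1] at this
    exact this
  have hmem : ∀ᶠ s : ℝ in 𝓝[>] 0, s ∈ Ioc (0 : ℝ) 1 := by
    filter_upwards [Ioc_mem_nhdsGT zero_lt_one] with s hs using hs
  have htend : Tendsto γ (𝓝[>] 0) (𝓝[≠] x₀) := by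
    refine tendsto_nhdsWithin_iff.2 ⟨?_, ?_⟩
    · rw [tendsto_iff_dist_tendsto_zero]
      have h1 : Tendsto (fun s : ℝ => s * dist x₀ y) (𝓝[>] 0) (𝓝 0) := by
        have : Continuous fun s : ℝ => s * dist x₀ y := by fun_prop
        simpa using (this.tendsto 0).mono_left (nhdsWithin_le_nhds (s := Ioi 0))
      refine h1.congr' ?_
      filter_upwards [hmem] with s hs
      rw [dist_comm (γ s), hdist s ⟨hs.1.le, hs.2⟩]
    · filter_upwards [hmem] with s hs
      have := hdist s ⟨hs.1.le, hs.2⟩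
      have h2 : 0 < dist x₀ (γ s) := by rw [this]; exact mul_pos hs.1 hpos
      exact (dist_pos.1 h2).symm
  have hslope : ∀ ε > 0, val φ x₀ - val φ y + lam / 2 * dist x₀ y ^ 2 ≤ ε * dist x₀ y := by
    intro ε hε
    have hev : ∀ᶠ z in 𝓝[≠] x₀, (max (φ x₀ - φ z) 0).toENNReal / edist x₀ z < ENNReal.ofReal ε := by
      refine eventually_lt_of_limsup_lt ?_
      change localSlope φ x₀ < _
      rw [h]
      exact ENNReal.ofReal_pos.2 hε
    have hlim : Tendsto (fun s : ℝ => val φ x₀ - val φ y + lam / 2 * (1 - s) * dist x₀ y ^ 2)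
        (𝓝[>] 0) (𝓝 (val φ x₀ - val φ y + lam / 2 * dist x₀ y ^ 2)) := by
      have : Continuous fun s : ℝ => val φ x₀ - val φ y + lam / 2 * (1 - s) * dist x₀ y ^ 2 := by
        fun_prop
      simpa using (this.tendsto 0).mono_left (nhdsWithin_le_nhds (s := Ioi 0))
    refine le_of_tendsto hlim ?_
    filter_upwards [hmem, htend.eventually hev] with s hs h1
    have hs' : s ∈ Icc (0 : ℝ) 1 := ⟨hs.1.le, hs.2⟩
    have h2 := hγc s hs'
    have hd := mem_dom_of_le h2
    have h3 := val_le_of_le hbot h2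
    have hdp : 0 < dist x₀ (γ s) := by rw [hdist s hs']; exact mul_pos hs.1 hpos
    rw [slope_quotient_eq hbot hx₀ hd hdp, ENNReal.ofReal_lt_ofReal_iff hε,
      div_lt_iff₀ hdp, hdist s hs'] at h1
    have h4 := (le_max_left _ _).trans_lt h1
    have h5 : s * (val φ x₀ - val φ y + lam / 2 * (1 - s) * dist x₀ y ^ 2) ≤
        s * (ε * dist x₀ y) := by linarith
    exact le_of_mul_le_mul_left h5 hs.1
  have hlim : Tendsto (fun ε : ℝ => ε * dist x₀ y) (𝓝[>] 0) (𝓝 0) := by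
    have : Continuous fun s : ℝ => s * dist x₀ y := by fun_prop
    simpa using (this.tendsto 0).mono_left (nhdsWithin_le_nhds (s := Ioi 0))
  have := ge_of_tendsto hlim (by filter_upwards [self_mem_nhdsWithin] with ε hε using hslope ε hε)
  linarith

/-- A point with a quadratic lower bound for the potential is fixed by gradient curves. -/
lemma IsGradientCurve.eq_of_val_sub_le (hbot : ∀ x, φ x ≠ ⊥) {x₀ : X} (hx₀ : x₀ ∈ dom φ) {c : ℝ}
    (h : ∀ y ∈ dom φ, val φ x₀ - val φ y ≤ c * dist x₀ y ^ 2) {ξ : ℝ≥0 → X}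
    (hξ : IsGradientCurve φ x₀ ξ) (t : ℝ≥0) : ξ t = x₀ := by
  obtain ⟨p, x, hp, hpm, hx, hxξ⟩ := hξ
  obtain ⟨ε, hε, hpε⟩ := exists_real_mesh hpm
  refine tendsto_nhds_unique (hxξ t) (Tendsto.congr' ?_ tendsto_const_nhds)
  filter_upwards [hpε, hε.eventually (gt_mem_nhds (by positivity : 0 < 1 / (2 * (|c| + 1))))]
    with i h1 h2
  -- Minimality and the quadratic bound give `d² ≤ 2τ|c| d²` for a step from `x₀`, and the mesh
  -- makes `2τ|c| < 1`.
  have hall : ∀ k, x i k = x₀ := by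
    intro k
    induction k with
    | zero => exact (hx i).1
    | succ k ih =>
      have hτ : 0 < p i (k + 1) - p i k := sub_pos.2 ((hp i).2.1 (Nat.lt_succ_self k))
      have h3 := (hx i).step hbot hx₀ (hp i) k
      have h4 := h _ ((hx i).mem_dom hbot hx₀ (k + 1))
      rw [ih] at h3
      have h5 := (h1 k).trans h2.le
      rw [le_div_iff₀ (by positivity)] at h5
      have h6 := mul_le_mul_of_nonneg_right (le_abs_self c) (sq_nonneg (dist x₀ (x i (k + 1))))
      have h7 := mul_le_mul_of_nonneg_left (h4.trans h6) hτ.le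
      have h9 := sq_nonneg (dist x₀ (x i (k + 1)))
      have h8 := mul_le_mul_of_nonneg_right h5 h9
      have h11 := mul_nonneg hτ.le h9
      by_contra hne
      have h10 : 0 < dist x₀ (x i (k + 1)) := dist_pos.2 (Ne.symm hne)
      have := mul_pos hτ (pow_pos h10 2)
      linarith
  exact (hall _).symm

lemma FlowSetting.localSlope_eq_zero_iff (S : FlowSetting φ C L) {lam : ℝ}
    (hconv : IsLambdaConvex φ lam) {x₀ : X} (hx₀ : x₀ ∈ dom φ) {ξ : ℝ≥0 → X}
    (hξ : IsGradientCurve φ x₀ ξ) : localSlope φ x₀ = 0 ↔ ∀ t, 0 < t → ξ t = x₀ :=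
  ⟨fun h t _ => hξ.eq_of_val_sub_le S.bot hx₀
    (fun _ hy => val_sub_le_of_localSlope_eq_zero S.bot hconv hx₀ h hy) t,
  fun h => localSlope_eq_zero_of_val_sub_le S.bot hx₀
    fun _ hy => S.val_sub_le_of_stationary hx₀ hξ h hy⟩

lemma gradientFlow_eq {x₀ : X} {ξ : ℝ≥0 → X} (h : ∃! ξ, IsGradientCurve φ x₀ ξ)
    (hξ : IsGradientCurve φ x₀ ξ) (t : ℝ≥0) : gradientFlow φ t x₀ = ξ t := by
  have h1 : IsGradientCurve φ x₀
      (@Classical.epsilon (ℝ≥0 → X) ⟨fun _ => x₀⟩ (IsGradientCurve φ x₀)) :=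
    Classical.epsilon_spec ⟨ξ, hξ⟩
  exact congrFun (h.unique h1 hξ) t

lemma FlowSetting.gradientFlow_stationary_iff [CompleteSpace X] (S : FlowSetting φ C L) {lam : ℝ}
    (hconv : IsLambdaConvex φ lam) {x₀ : X} (hx₀ : x₀ ∈ dom φ) :
    (∃! ξ, IsGradientCurve φ x₀ ξ) ∧
      (localSlope φ x₀ = 0 ↔ ∀ t : ℝ≥0, 0 < t → gradientFlow φ t x₀ = x₀) := by
  have h := S.existsUnique_gradientCurve hx₀
  obtain ⟨ξ, hξ⟩ := h.exists
  refine ⟨h, ?_⟩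
  simp only [gradientFlow_eq h hξ]
  exact S.localSlope_eq_zero_iff hconv hx₀ hξ

end Stationary

/-! ### Trigonometric inequalities -/

lemma mul_sin_le_mul_sin {p q : ℝ} (hp : 0 ≤ p) (hpq : p ≤ q) (hq : q ≤ Real.pi) :
    p * Real.sin q ≤ q * Real.sin p := by
  rcases eq_or_lt_of_le (hp.trans hpq) with h0 | h0
  · have : p = 0 := by linarith
    subst this; simp [← h0]
  have h := strictConcaveOn_sin_Icc.concaveOn.2 (show (0 : ℝ) ∈ _ from ⟨le_rfl, Real.pi_pos.le⟩)
    (show q ∈ _ from ⟨h0.le, hq⟩) (show 0 ≤ 1 - p / q by rw [sub_nonneg, div_le_one h0]; exact hpq)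
    (show 0 ≤ p / q by positivity) (by ring)
  simp only [smul_eq_mul, mul_zero, Real.sin_zero, zero_add] at h
  rw [div_mul_cancel₀ _ h0.ne'] at h
  rw [div_mul_eq_mul_div, div_le_iff₀ h0] at h
  linarith

/-- Convexity of `arccos ^ 2`, as a tangent line inequality. -/
lemma two_mul_cos_sub_cos_le {p q : ℝ} (hp : 0 ≤ p) (hp' : p ≤ Real.pi) (hq : 0 ≤ q)
    (hq' : q ≤ Real.pi) : 2 * (Real.cos q - Real.cos p) ≤ (p ^ 2 - q ^ 2) * Real.sinc q := by
  rcases eq_or_lt_of_le hq with rfl | h0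
  · have := Real.one_sub_sq_div_two_le_cos (x := p)
    simp; linarith
  -- Since `sinc` decreases on `[0,π]`, `F' = 2(p sin q - q sin p)` changes sign at `p = q`, the
  -- minimum of `F`.
  set F : ℝ → ℝ := fun p => p ^ 2 * Real.sin q + 2 * q * Real.cos p with hF
  have hd : ∀ p, HasDerivAt F (2 * (p * Real.sin q - q * Real.sin p)) p := fun p => by
    have h1 := ((hasDerivAt_pow 2 p).mul_const (Real.sin q)).add
      ((Real.hasDerivAt_cos p).const_mul (2 * q))
    refine h1.congr_deriv ?_
    simp; ring
  have hc : Continuous F := by rw [hF]; fun_prop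
  have key : F q ≤ F p := by
    rcases le_total p q with h | h
    · have : AntitoneOn F (Icc 0 q) := by
        refine antitoneOn_of_deriv_nonpos (convex_Icc _ _) hc.continuousOn
          (fun x _ => (hd x).differentiableAt.differentiableWithinAt) fun x hx => ?_
        rw [interior_Icc] at hx
        rw [(hd x).deriv]
        have := mul_sin_le_mul_sin hx.1.le hx.2.le hq'
        linarith
      exact this ⟨hp, h⟩ ⟨h0.le, le_rfl⟩ h
    · have : MonotoneOn F (Icc q Real.pi) := by
        refine monotoneOn_of_deriv_nonneg (convex_Icc _ _) hc.continuousOn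
          (fun x _ => (hd x).differentiableAt.differentiableWithinAt) fun x hx => ?_
        rw [interior_Icc] at hx
        rw [(hd x).deriv]
        have := mul_sin_le_mul_sin hq hx.1.le hx.2.le
        linarith
      exact this ⟨le_rfl, hq'⟩ ⟨h, hp'⟩ h
  rw [Real.sinc_of_ne_zero h0.ne', mul_div_assoc', le_div_iff₀ h0]
  simp only [hF] at key
  linarith

lemma one_sub_sinc_le {a : ℝ} (ha : 0 ≤ a) : 1 - Real.sinc a ≤ a ^ 2 := by
  rcases eq_or_lt_of_le ha with rfl | h0
  · simp
  rw [Real.sinc_of_ne_zero h0.ne', sub_le_iff_le_add, ← sub_le_iff_le_add', le_div_iff₀ h0]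
  have := Real.sin_gt_sub_cube h0
  nlinarith [pow_pos h0 3]

lemma half_le_sinc {a : ℝ} (ha : 0 ≤ a) (ha' : a ≤ Real.pi / 2) : 1 / 2 ≤ Real.sinc a := by
  rcases eq_or_lt_of_le ha with rfl | h0
  · norm_num
  rw [Real.sinc_of_ne_zero h0.ne', le_div_iff₀ h0]
  have h1 := Real.mul_le_sin ha ha'
  have h2 : 1 / 2 ≤ 2 / Real.pi := by
    rw [div_le_div_iff₀ (by norm_num) Real.pi_pos]
    linarith [Real.pi_le_four]
  nlinarith

/-! ### Consequences of the comparison with the sphere -/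

lemma inner_eq_cos_sphereDist (a b : S2) :
    inner ℝ (a : EuclideanSpace ℝ (Fin 3)) (b : EuclideanSpace ℝ (Fin 3)) =
      Real.cos (sphereDist a b) := by
  have ha : ‖(a : EuclideanSpace ℝ (Fin 3))‖ = 1 := by simp
  have hb : ‖(b : EuclideanSpace ℝ (Fin 3))‖ = 1 := by simp
  rw [sphereDist, InnerProductGeometry.cos_angle, ha, hb]
  simp

/-- Pairing with `x` the vector identity `sin l • γ(t) = sin((1-t)l) • y + sin(tl) • z`. The latter
holds because the squared norm of the difference, computed from the known angles, is zero. -/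
lemma sphere_geodesic_identity {y z : S2} {γ : ℝ → S2} (hγ : IsMinGeodesic sphereDist γ y z)
    (x : S2) {t : ℝ} (ht : t ∈ Icc (0 : ℝ) 1) :
    Real.sin (sphereDist y z) * Real.cos (sphereDist x (γ t)) =
      Real.sin ((1 - t) * sphereDist y z) * Real.cos (sphereDist x y) +
      Real.sin (t * sphereDist y z) * Real.cos (sphereDist x z) := by
  set l := sphereDist y z with hl
  have h1 : sphereDist y (γ t) = t * l := by
    have := hγ.2.2 0 (by simp) t ht
    rwa [hγ.1, zero_sub, abs_neg, abs_of_nonneg ht.1] at this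
  have h2 : sphereDist (γ t) z = (1 - t) * l := by
    have := hγ.2.2 t ht 1 (by simp)
    rwa [hγ.2.1, abs_sub_comm, abs_of_nonneg (sub_nonneg.2 ht.2)] at this
  have hnorm : ∀ a : S2, inner ℝ (a : EuclideanSpace ℝ (Fin 3)) (a : EuclideanSpace ℝ (Fin 3)) =
      (1 : ℝ) := fun a => by
    have ha : ‖(a : EuclideanSpace ℝ (Fin 3))‖ = 1 := by simp
    rw [real_inner_self_eq_norm_sq, ha]; norm_num
  have e1 := inner_eq_cos_sphereDist y (γ t)
  have e2 := inner_eq_cos_sphereDist (γ t) z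
  have e3 := inner_eq_cos_sphereDist y z
  rw [h1] at e1
  rw [h2] at e2
  rw [← hl] at e3
  have hsum : l = (1 - t) * l + t * l := by ring
  have e4 : Real.sin l = Real.sin ((1 - t) * l) * Real.cos (t * l) +
      Real.cos ((1 - t) * l) * Real.sin (t * l) := by
    rw [← Real.sin_add, ← hsum]
  have e5 : Real.cos l = Real.cos ((1 - t) * l) * Real.cos (t * l) -
      Real.sin ((1 - t) * l) * Real.sin (t * l) := by
    rw [← Real.cos_add, ← hsum]
  have e6 := Real.sin_sq_add_cos_sq ((1 - t) * l)
  have e7 := Real.sin_sq_add_cos_sq (t * l)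
  set sA := Real.sin ((1 - t) * l)
  set cA := Real.cos ((1 - t) * l)
  set sB := Real.sin (t * l)
  set cB := Real.cos (t * l)
  have hv : Real.sin l • (γ t : EuclideanSpace ℝ (Fin 3)) =
      sA • (y : EuclideanSpace ℝ (Fin 3)) + sB • (z : EuclideanSpace ℝ (Fin 3)) := by
    rw [← sub_eq_zero, ← inner_self_eq_zero (𝕜 := ℝ)]
    simp only [inner_sub_left, inner_sub_right, inner_add_left, inner_add_right,
      real_inner_smul_left, real_inner_smul_right, hnorm]
    rw [real_inner_comm (y : EuclideanSpace ℝ (Fin 3)) (γ t : EuclideanSpace ℝ (Fin 3)),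
      real_inner_comm (γ t : EuclideanSpace ℝ (Fin 3)) (z : EuclideanSpace ℝ (Fin 3)),
      real_inner_comm (y : EuclideanSpace ℝ (Fin 3)) (z : EuclideanSpace ℝ (Fin 3))]
    simp only [e1, e2, e3]
    rw [e4, e5]
    have e6' : cA ^ 2 = 1 - sA ^ 2 := by linarith
    have e7' : cB ^ 2 = 1 - sB ^ 2 := by linarith
    ring_nf
    rw [e6', e7']
    ring
  have h := congrArg (fun v => inner ℝ (x : EuclideanSpace ℝ (Fin 3)) v) hv
  simp only [inner_add_right, real_inner_smul_right, inner_eq_cos_sphereDist] at h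
  exact h

section Cat

variable {X : Type*} [MetricSpace X]

lemma IsMinGeodesic.dist_left {γ : ℝ → X} {y z : X} (hγ : IsMinGeodesic dist γ y z) {t : ℝ}
    (ht : t ∈ Icc (0 : ℝ) 1) : dist y (γ t) = t * dist y z := by
  have := hγ.2.2 0 (by simp) t ht
  rwa [hγ.1, zero_sub, abs_neg, abs_of_nonneg ht.1] at this

/-- The spherical identity becomes an inequality, as the cosine decreases on `[0,π]`; the comparison
angle is at most `π`, which also bounds `d(x, γ t)`. -/
lemma IsCAT1.sin_mul_cos_ge (h : IsCAT1 X) {x y z : X}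
    (hper : dist x y + dist y z + dist z x < 2 * Real.pi) {γ : ℝ → X}
    (hγ : IsMinGeodesic dist γ y z) {t : ℝ} (ht : t ∈ Icc (0 : ℝ) 1) :
    dist x (γ t) ≤ Real.pi ∧
    Real.sin ((1 - t) * dist y z) * Real.cos (dist x y) +
      Real.sin (t * dist y z) * Real.cos (dist x z) ≤
      Real.sin (dist y z) * Real.cos (dist x (γ t)) := by
  obtain ⟨x', y', z', hxy, hyz, hzx, γ', hγ', hle⟩ := h.2 x y z hper γ hγ
  have hpi : sphereDist x' (γ' t) ≤ Real.pi := InnerProductGeometry.angle_le_pi _ _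
  refine ⟨(hle t ht).trans hpi, ?_⟩
  have hid := sphere_geodesic_identity hγ' x' ht
  have hxz : sphereDist x' z' = dist x z := by
    rw [dist_comm, ← hzx, sphereDist, sphereDist, InnerProductGeometry.angle_comm]
  rw [hyz, hxy, hxz] at hid
  rw [← hid]
  have hlpi : dist y z ≤ Real.pi := by
    have := dist_triangle y x z
    rw [dist_comm y x, dist_comm x z] at this
    linarith
  exact mul_le_mul_of_nonneg_left
    (Real.cos_le_cos_of_nonneg_of_le_pi dist_nonneg hpi (hle t ht))
    (Real.sin_nonneg_of_nonneg_of_le_pi dist_nonneg hlpi)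

/-- Balls of radius at most `π / 3` are convex. -/
lemma IsCAT1.dist_le_of_dist_le (h : IsCAT1 X) {x y z : X} {r : ℝ} (hr : r ≤ Real.pi / 3)
    (hy : dist x y ≤ r) (hz : dist x z ≤ r) (hyz : dist y z < Real.pi) {γ : ℝ → X}
    (hγ : IsMinGeodesic dist γ y z) {t : ℝ} (ht : t ∈ Icc (0 : ℝ) 1) : dist x (γ t) ≤ r := by
  rcases eq_or_lt_of_le (dist_nonneg (x := y) (y := z)) with h0 | h0
  · have := hγ.dist_left ht
    rw [← h0, mul_zero] at this
    rw [← dist_eq_zero.1 this]; exact hy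
  have hr0 : 0 ≤ r := dist_nonneg.trans hy
  have hpi := Real.pi_pos
  have hper : dist x y + dist y z + dist z x < 2 * Real.pi := by
    have := dist_comm z x
    linarith
  obtain ⟨hle, hcos⟩ := h.sin_mul_cos_ge hper hγ ht
  have ht0 := ht.1
  have ht1 : 0 ≤ 1 - t := sub_nonneg.2 ht.2
  have hA : 0 ≤ Real.sin ((1 - t) * dist y z) :=
    Real.sin_nonneg_of_nonneg_of_le_pi (by positivity) (by nlinarith)
  have hB : 0 ≤ Real.sin (t * dist y z) :=
    Real.sin_nonneg_of_nonneg_of_le_pi (by positivity) (by nlinarith [ht.2])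
  have hs : 0 < Real.sin (dist y z) := Real.sin_pos_of_pos_of_lt_pi h0 hyz
  have hcr : 0 ≤ Real.cos r := Real.cos_nonneg_of_neg_pi_div_two_le_of_le (by linarith)
    (by linarith)
  have c1 : Real.cos r ≤ Real.cos (dist x y) :=
    Real.cos_le_cos_of_nonneg_of_le_pi dist_nonneg (by linarith) hy
  have c2 : Real.cos r ≤ Real.cos (dist x z) :=
    Real.cos_le_cos_of_nonneg_of_le_pi dist_nonneg (by linarith) hz
  have hsub : Real.sin (dist y z) ≤ Real.sin ((1 - t) * dist y z) + Real.sin (t * dist y z) := by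
    have e : dist y z = (1 - t) * dist y z + t * dist y z := by ring
    have e4 : Real.sin (dist y z) = Real.sin ((1 - t) * dist y z) * Real.cos (t * dist y z) +
        Real.cos ((1 - t) * dist y z) * Real.sin (t * dist y z) := by
      rw [← Real.sin_add, ← e]
    rw [e4]
    have := mul_le_mul_of_nonneg_left (Real.cos_le_one (t * dist y z)) hA
    have := mul_le_mul_of_nonneg_right (Real.cos_le_one ((1 - t) * dist y z)) hB
    linarith
  have h1 : Real.sin (dist y z) * Real.cos r ≤ Real.sin (dist y z) * Real.cos (dist x (γ t)) := by
    have g1 := mul_le_mul_of_nonneg_right hsub hcr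
    have g2 := mul_le_mul_of_nonneg_left c1 hA
    have g3 := mul_le_mul_of_nonneg_left c2 hB
    linarith
  have h2 := le_of_mul_le_mul_left h1 hs
  by_contra hc
  push Not at hc
  have := Real.cos_lt_cos_of_nonneg_of_le_pi hr0 hle hc
  linarith

/-- Uniform convexity at midpoints of the squared distance from a point, in regions of diameter
less than `π / 2`. -/
lemma IsCAT1.sq_dist_midpoint_le (h : IsCAT1 X) {x y z : X} {D : ℝ} (hD : D < Real.pi / 2)
    (hxy : dist x y ≤ D) (hxz : dist x z ≤ D) (hyz : dist y z ≤ D) {γ : ℝ → X}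
    (hγ : IsMinGeodesic dist γ y z) :
    dist x (γ (1 / 2)) ^ 2 ≤
      (dist x y ^ 2 + dist x z ^ 2) / 2 - Real.cos D / Real.pi ^ 2 * dist y z ^ 2 := by
  have ht : (1 / 2 : ℝ) ∈ Icc (0 : ℝ) 1 := by norm_num
  have hpi := Real.pi_pos
  rcases eq_or_lt_of_le (dist_nonneg (x := y) (y := z)) with h0 | h0
  · have := hγ.dist_left ht
    rw [← h0, mul_zero] at this
    rw [← h0, ← dist_eq_zero.1 this, ← dist_eq_zero.1 h0.symm]
    linarith
  have hper : dist x y + dist y z + dist z x < 2 * Real.pi := by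
    have := dist_comm z x
    linarith
  obtain ⟨hle, hcos⟩ := h.sin_mul_cos_ge hper hγ ht
  have hD0 : 0 ≤ D := dist_nonneg.trans hxy
  set l := dist y z with hl
  set m := dist x (γ (1 / 2)) with hm
  have hm0 : 0 ≤ m := dist_nonneg
  have e1 : Real.sin l = 2 * Real.sin (1 / 2 * l) * Real.cos (1 / 2 * l) := by
    rw [← Real.sin_two_mul]; ring_nf
  have e2 : (1 - 1 / 2 : ℝ) * l = 1 / 2 * l := by ring
  have hs : 0 < Real.sin (1 / 2 * l) :=
    Real.sin_pos_of_pos_of_lt_pi (by positivity) (by linarith)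
  have hch : 0 < Real.cos (1 / 2 * l) := Real.cos_pos_of_mem_Ioo ⟨by linarith, by linarith⟩
  have hcD : 0 < Real.cos D := Real.cos_pos_of_mem_Ioo ⟨by linarith, hD⟩
  rw [e1, e2] at hcos
  have h1 : Real.cos (dist x y) + Real.cos (dist x z) ≤ 2 * Real.cos (1 / 2 * l) * Real.cos m := by
    refine le_of_mul_le_mul_left ?_ hs
    linarith
  have c1 : Real.cos D ≤ Real.cos (dist x y) :=
    Real.cos_le_cos_of_nonneg_of_le_pi dist_nonneg (by linarith) hxy
  have c2 : Real.cos D ≤ Real.cos (dist x z) :=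
    Real.cos_le_cos_of_nonneg_of_le_pi dist_nonneg (by linarith) hxz
  have h2 : Real.cos D ≤ Real.cos (1 / 2 * l) * Real.cos m := by linarith
  have hcm : 0 < Real.cos m := by
    by_contra hc
    push Not at hc
    nlinarith
  have hcDm : Real.cos D ≤ Real.cos m := by nlinarith [Real.cos_le_one (1 / 2 * l)]
  have hmlt : m < Real.pi := by
    rcases eq_or_lt_of_le hle with h' | h'
    · rw [h', Real.cos_pi] at hcm; linarith
    · exact h'
  have hsinc : 0 < Real.sinc m := by
    rcases eq_or_lt_of_le hm0 with h' | h'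
    · rw [← h']; simp
    · rw [Real.sinc_of_ne_zero h'.ne']
      exact div_pos (Real.sin_pos_of_pos_of_lt_pi h' hmlt) h'
  -- Adding the two tangent inequalities at `m` to `h1` gives `4 cos m (1 - cos(l/2)) ≤ V sinc m`.
  -- The quadratic bound on `cos(l/2)` then yields `2 cos D / π² · l² ≤ V`.
  have t1 := two_mul_cos_sub_cos_le (p := dist x y) dist_nonneg (by linarith) hm0 hle
  have t2 := two_mul_cos_sub_cos_le (p := dist x z) dist_nonneg (by linarith) hm0 hle
  have hq : Real.cos (1 / 2 * l) ≤ 1 - 2 / Real.pi ^ 2 * (1 / 2 * l) ^ 2 :=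
    Real.cos_le_one_sub_mul_cos_sq (by rw [abs_of_nonneg (by positivity)]; linarith)
  set V := dist x y ^ 2 + dist x z ^ 2 - 2 * m ^ 2 with hV
  have h3 : 4 * Real.cos D * (1 - Real.cos (1 / 2 * l)) ≤ V * Real.sinc m := by
    have := mul_le_mul_of_nonneg_right hcDm (sub_nonneg.2 (Real.cos_le_one (1 / 2 * l)))
    rw [hV]; linarith
  have hq0 : 0 ≤ 1 - Real.cos (1 / 2 * l) := sub_nonneg.2 (Real.cos_le_one _)
  have hV0 : 0 ≤ V := by
    have : 0 ≤ V * Real.sinc m := le_trans (by positivity) h3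
    exact nonneg_of_mul_nonneg_left this hsinc
  have h4 : V * Real.sinc m ≤ V := mul_le_of_le_one_right hV0 (Real.sinc_le_one m)
  have h5 := mul_le_mul_of_nonneg_left hq (by positivity : 0 ≤ 4 * Real.cos D)
  have h6 : Real.cos D / Real.pi ^ 2 * l ^ 2 =
      2 * Real.cos D * (2 / Real.pi ^ 2 * (1 / 2 * l) ^ 2) := by
    field_simp
  rw [h6]
  linarith

end Cat

/-! ### First variation, minimizers and the discrete EVI -/

section Cat

variable {X : Type*} [MetricSpace X]

/-- The first variation inequality in regions of diameter less than `π / 2`. -/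
lemma IsCAT1.first_variation_le (h : IsCAT1 X) {x z y : X} {D : ℝ} (hD : D < Real.pi / 2)
    (hxz : dist x z ≤ D) (hxy : dist x y ≤ D) (hzy : dist z y ≤ D) (hne : z ≠ y) {γ : ℝ → X}
    (hγ : IsMinGeodesic dist γ z y) {E : ℝ → ℝ} {E₀ : ℝ} (hE : Tendsto E (𝓝[>] 0) (𝓝 E₀))
    (hle : ∀ s ∈ Ioc (0 : ℝ) 1, s * E s ≤ dist x (γ s) ^ 2 - dist x z ^ 2) :
    E₀ ≤ dist x y ^ 2 - dist z y ^ 2 + 8 * dist x z ^ 2 := by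
  have hpi := Real.pi_pos
  have hpi4 := Real.pi_le_four
  have hper : dist x z + dist z y + dist y x < 2 * Real.pi := by
    have := dist_comm y x
    linarith
  have hcos := fun s hs => h.sin_mul_cos_ge hper hγ (t := s) hs
  have hdl := fun s hs => hγ.dist_left (t := s) hs
  have hb0 : 0 < dist z y := dist_pos.2 hne
  have ha0 : 0 ≤ dist x z := dist_nonneg
  have hc0 : 0 ≤ dist x y := dist_nonneg
  have hmem : ∀ᶠ s : ℝ in 𝓝[>] 0, s ∈ Ioc (0 : ℝ) 1 := by
    filter_upwards [Ioc_mem_nhdsGT zero_lt_one] with s hs using hs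
  set a := dist x z with ha
  set b := dist z y with hb
  set c := dist x y with hc
  have hlim_d : Tendsto (fun s => dist x (γ s)) (𝓝[>] 0) (𝓝 a) := by
    refine tendsto_const_nhds.dist ?_
    rw [tendsto_iff_dist_tendsto_zero]
    have h1 : Tendsto (fun s : ℝ => s * b) (𝓝[>] 0) (𝓝 0) := by
      have : Continuous fun s : ℝ => s * b := by fun_prop
      simpa using (this.tendsto 0).mono_left (nhdsWithin_le_nhds (s := Ioi 0))
    refine h1.congr' ?_
    filter_upwards [hmem] with s hs
    rw [dist_comm (γ s), hdl s ⟨hs.1.le, hs.2⟩]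
  set g : ℝ → ℝ := fun s => 2 * (Real.sin b * Real.cos a - Real.sin ((1 - s) * b) * Real.cos a -
    Real.sin (s * b) * Real.cos c) with hg
  have hg0 : g 0 = 0 := by simp [hg]
  have hgd : HasDerivAt g (2 * (b * Real.cos b * Real.cos a - b * Real.cos c)) 0 := by
    have h1 : HasDerivAt (fun s : ℝ => (1 - s) * b) (-b) 0 := by
      simpa using ((hasDerivAt_id (0 : ℝ)).const_sub 1).mul_const b
    have h2 : HasDerivAt (fun s : ℝ => s * b) b 0 := by
      simpa using (hasDerivAt_id (0 : ℝ)).mul_const b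
    have h3 := (((h1.sin.mul_const (Real.cos a)).const_sub (Real.sin b * Real.cos a)).sub
      (h2.sin.mul_const (Real.cos c))).const_mul 2
    refine h3.congr_deriv ?_
    simp only [sub_zero, one_mul, zero_mul, Real.cos_zero]
    ring
  have hglim := hgd.tendsto_slope_zero_right
  simp only [zero_add, hg0, sub_zero, smul_eq_mul] at hglim
  have hsb : 0 < Real.sin b := Real.sin_pos_of_pos_of_lt_pi hb0 (by linarith)
  -- The lower bound `s E(s)` on the growth of `d²` becomes one on cosines by the tangent inequality
  -- at `d(x, γ s)`. Comparison bounds these by `g s`, and dividing by `s` leaves `g' 0`, so `d²(x,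
  -- γ s)` need not be differentiable.
  have key : Real.sin b * (E₀ * Real.sinc a) ≤
      2 * (b * Real.cos b * Real.cos a - b * Real.cos c) := by
    refine le_of_tendsto_of_tendsto (tendsto_const_nhds.mul
      (hE.mul ((Real.continuous_sinc.tendsto a).comp hlim_d))) hglim ?_
    have hsinc_ev : ∀ᶠ s in 𝓝[>] (0 : ℝ), 0 < Real.sinc (dist x (γ s)) := by
      have hsa : 0 < Real.sinc a :=
        lt_of_lt_of_le (by norm_num) (half_le_sinc ha0 (by linarith))
      exact ((Real.continuous_sinc.tendsto a).comp hlim_d).eventually (lt_mem_nhds hsa)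
    filter_upwards [hmem, hsinc_ev] with s hs hsinc
    obtain ⟨h1, h2⟩ := hcos s ⟨hs.1.le, hs.2⟩
    have h3 := two_mul_cos_sub_cos_le (p := a) ha0 (by linarith) dist_nonneg h1
    have h4 := hle s hs
    have h5 := mul_le_mul_of_nonneg_right h4 hsinc.le
    have h6 : s * E s * Real.sinc (dist x (γ s)) ≤
        2 * (Real.cos a - Real.cos (dist x (γ s))) := by linarith
    have h7 := mul_le_mul_of_nonneg_left h6 hsb.le
    have h8 : s * (Real.sin b * (E s * Real.sinc (dist x (γ s)))) ≤ g s := by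
      simp only [hg]; linarith
    rw [mul_comm] at h8
    change Real.sin b * (E s * Real.sinc (dist x (γ s))) ≤ s⁻¹ * g s
    rw [inv_mul_eq_div, le_div_iff₀ hs.1]
    exact h8
  have hsincb : Real.sin b = b * Real.sinc b := by
    rw [Real.sinc_of_ne_zero hb0.ne']; field_simp
  have hsb2 : 0 < Real.sinc b := lt_of_lt_of_le (by norm_num) (half_le_sinc hb0.le (by linarith))
  have t := two_mul_cos_sub_cos_le (p := c) hc0 (by linarith) hb0.le (by linarith)
  have hcb : 0 ≤ Real.cos b := Real.cos_nonneg_of_neg_pi_div_two_le_of_le (by linarith)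
    (by linarith)
  have k1 : Real.sinc b * (E₀ * Real.sinc a) ≤ 2 * (Real.cos b * Real.cos a - Real.cos c) := by
    rw [hsincb] at key
    refine le_of_mul_le_mul_left ?_ hb0
    linarith
  have k2 : Real.sinc b * (E₀ * Real.sinc a) ≤ Real.sinc b * (c ^ 2 - b ^ 2) := by
    have := mul_le_mul_of_nonneg_left (Real.cos_le_one a) hcb
    linarith
  have k3 := le_of_mul_le_mul_left k2 hsb2
  have k4 := half_le_sinc ha0 (show a ≤ Real.pi / 2 by linarith)
  have k5 := one_sub_sinc_le ha0
  have k6 := Real.sinc_le_one a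
  -- So far `E₀ sinc a ≤ c² - b²`. If `E₀ ≥ 0`, then `sinc a ≥ 1/2` and `c ≤ 2` give `E₀ ≤ 8`, so
  -- removing `sinc a` costs at most `8 a²`.
  rcases le_total E₀ 0 with h0 | h0
  · nlinarith
  · have hE8 : E₀ ≤ 8 := by nlinarith
    nlinarith [mul_le_mul_of_nonneg_left k5 h0]

variable {φ : X → EReal}

/-- A quadratic lower bound for lower semicontinuous semiconvex functions, with a leading
coefficient depending on the convexity constant only. -/
lemma exists_val_sub_le (hbot : ∀ x, φ x ≠ ⊥) (hlsc : LowerSemicontinuous φ) {lam : ℝ}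
    (hconv : IsLambdaConvex φ lam) {x : X} (hx : x ∈ dom φ) :
    ∃ A > 0, ∀ y ∈ dom φ, val φ x - val φ y ≤ A + (1 + |lam|) * dist x y ^ 2 := by
  have hlt : ((val φ x - 1 : ℝ) : EReal) < φ x := by
    rw [← coe_val hbot hx]
    exact_mod_cast sub_one_lt _
  obtain ⟨r, hr, hball⟩ := Metric.eventually_nhds_iff.1 (hlsc x _ hlt)
  refine ⟨1 + 1 / r ^ 2, by positivity, fun y hy => ?_⟩
  have hnear : ∀ z ∈ dom φ, dist x z < r → val φ x - 1 ≤ val φ z := fun z hz hd => by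
    have h1 : ((val φ x - 1 : ℝ) : EReal) < φ z := hball (by rwa [dist_comm])
    rw [← coe_val hbot hz] at h1
    have h2 : val φ x - 1 < val φ z := by exact_mod_cast h1
    exact h2.le
  have hlam := abs_nonneg lam
  rcases lt_or_ge (dist x y) r with hlt | hge
  · have := hnear y hy hlt
    have h2 : 0 ≤ 1 / r ^ 2 := by positivity
    have h3 : 0 ≤ (1 + |lam|) * dist x y ^ 2 := by positivity
    linarith
  · obtain ⟨γ, hγ, hγc⟩ := hconv x hx y hy
    have hpos : 0 < dist x y := hr.trans_le hge
    -- Places `γ s` at distance `r/2` from `x`, where semicontinuity bounds `φ` below; convexity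
    -- extrapolates from there to `y`.
    set s := r / (2 * dist x y) with hs
    have hs0 : 0 < s := by positivity
    have hs1 : s ≤ 1 / 2 := by rw [hs, div_le_iff₀ (by positivity)]; linarith
    have hsI : s ∈ Icc (0 : ℝ) 1 := ⟨hs0.le, by linarith⟩
    have hd := hγ.dist_left hsI
    have hsd : s * dist x y = r / 2 := by rw [hs]; field_simp
    have h1 := hγc s hsI
    have h2 := val_le_of_le hbot h1
    have h3 := hnear _ (mem_dom_of_le h1) (by rw [hd, hsd]; linarith)
    have h4 : s * (val φ x - val φ y) ≤ s * (1 / s - lam / 2 * (1 - s) * dist x y ^ 2) := by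
      have : s * (1 / s) = 1 := by field_simp
      linarith
    have h5 := le_of_mul_le_mul_left h4 hs0
    have h6 : 1 / s = 2 * (dist x y * (1 / r)) := by rw [hs]; field_simp
    have h7 : 2 * (dist x y * (1 / r)) ≤ dist x y ^ 2 + 1 / r ^ 2 := by
      have := sq_nonneg (dist x y - 1 / r)
      have e : (1 / r) ^ 2 = 1 / r ^ 2 := by rw [one_div, one_div, inv_pow]
      linarith [sub_sq (dist x y) (1 / r)]
    have h8 : -(lam / 2 * (1 - s) * dist x y ^ 2) ≤ |lam| * dist x y ^ 2 := by
      have g1 : -lam * (1 - s) ≤ |lam| * (1 - s) :=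
        mul_le_mul_of_nonneg_right (neg_le_abs lam) (by linarith)
      have g2 : |lam| * (1 - s) ≤ |lam| := mul_le_of_le_one_right hlam (by linarith)
      have g3 : -(lam / 2 * (1 - s)) ≤ |lam| := by linarith
      have := mul_le_mul_of_nonneg_right g3 (sq_nonneg (dist x y))
      linarith
    linarith

lemma IsCAT1.evi (h : IsCAT1 X) (hbot : ∀ x, φ x ≠ ⊥) {lam D : ℝ} (hconv : IsLambdaConvex φ lam)
    (hD : D < Real.pi / 2) (hdiam : ∀ x ∈ dom φ, ∀ y ∈ dom φ, dist x y ≤ D) {τ : ℝ} (hτ : 0 < τ)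
    {x y z : X} (hx : x ∈ dom φ) (hy : y ∈ dom φ) (hz : z ∈ proxSet φ τ x) :
    dist z y ^ 2 ≤ dist x y ^ 2 + 8 * dist x z ^ 2 + 2 * τ * (val φ y - val φ z)
      + |lam| * τ * dist z y ^ 2 := by
  obtain ⟨hzd, hmin⟩ := prox_spec hbot hx hz
  rcases eq_or_ne z y with rfl | hne
  · simp only [dist_self, sub_self]
    have := sq_nonneg (dist x z)
    linarith
  obtain ⟨γ, hγ, hγc⟩ := hconv z hzd y hy
  have hfv := h.first_variation_le (x := x) hD (hdiam _ hx _ hzd) (hdiam _ hx _ hy)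
    (hdiam _ hzd _ hy) hne hγ
    (E := fun s => 2 * τ * (val φ z - val φ y + lam / 2 * (1 - s) * dist z y ^ 2))
    (E₀ := 2 * τ * (val φ z - val φ y + lam / 2 * (1 - 0) * dist z y ^ 2))
    (by
      have : Continuous fun s : ℝ =>
        2 * τ * (val φ z - val φ y + lam / 2 * (1 - s) * dist z y ^ 2) := by fun_prop
      exact (this.tendsto 0).mono_left nhdsWithin_le_nhds)
    (fun s hs => by
      have h1 := hγc s ⟨hs.1.le, hs.2⟩
      have h2 := val_le_of_le hbot h1
      have h3 := hmin _ (mem_dom_of_le h1)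
      have h4 : (dist x z ^ 2 - dist x (γ s) ^ 2) / (2 * τ) ≤ val φ (γ s) - val φ z := by
        rw [sub_div]; linarith
      rw [div_le_iff₀ (by positivity)] at h4
      have h5 := mul_le_mul_of_nonneg_left h2 hτ.le
      linarith)
  have := mul_le_mul_of_nonneg_left (neg_le_abs lam) (mul_nonneg hτ.le (sq_nonneg (dist z y)))
  linarith

/-- For small `τ` the midpoint gain of `d²/(2τ)` outweighs the defect `|lam|` of `φ`, so minimizing
sequences are Cauchy. -/
lemma IsCAT1.proxSet_nonempty [CompleteSpace X] (h : IsCAT1 X) (hbot : ∀ x, φ x ≠ ⊥)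
    (hlsc : LowerSemicontinuous φ) {lam D : ℝ} (hconv : IsLambdaConvex φ lam)
    (hD : D < Real.pi / 2) (hdiam : ∀ x ∈ dom φ, ∀ y ∈ dom φ, dist x y ≤ D) {x : X}
    (hx : x ∈ dom φ) {τ : ℝ} (hτ : 0 < τ)
    (hτs : τ * (|lam| + 1) < Real.cos D / Real.pi ^ 2) : (proxSet φ τ x).Nonempty := by
  obtain ⟨A, hA, hlow⟩ := exists_val_sub_le hbot hlsc hconv hx
  set ψ : X → ℝ := fun y => val φ y + dist x y ^ 2 / (2 * τ) with hψ
  have hbdd : BddBelow (ψ '' dom φ) := by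
    refine ⟨val φ x - (A + (1 + |lam|) * D ^ 2), ?_⟩
    rintro _ ⟨y, hy, rfl⟩
    have h1 := hlow y hy
    have h2 : (1 + |lam|) * dist x y ^ 2 ≤ (1 + |lam|) * D ^ 2 := by
      gcongr; exact hdiam x hx y hy
    have h3 : 0 ≤ dist x y ^ 2 / (2 * τ) := by positivity
    simp only [hψ]
    linarith
  have hne : (ψ '' dom φ).Nonempty := ⟨_, x, hx, rfl⟩
  set I := sInf (ψ '' dom φ) with hI
  have hIle : ∀ y ∈ dom φ, I ≤ ψ y := fun y hy => csInf_le hbdd ⟨y, hy, rfl⟩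
  have hseq : ∀ n : ℕ, ∃ y ∈ dom φ, ψ y < I + 1 / ((n : ℝ) + 1) := by
    intro n
    obtain ⟨_, ⟨y, hy, rfl⟩, hlt⟩ := exists_lt_of_csInf_lt hne
      (lt_add_of_pos_right I (by positivity : (0 : ℝ) < 1 / ((n : ℝ) + 1)))
    exact ⟨y, hy, hlt⟩
  choose u hud hu using hseq
  have hcau : CauchySeq u := by
    refine cauchySeq_of_le_tendsto_0 (fun n : ℕ => √(2 * (1 / ((n : ℝ) + 1)))) ?_ ?_
    · intro n m N hn hm
      refine Real.le_sqrt_of_sq_le ?_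
      have hbound : ∀ k, N ≤ k → ψ (u k) ≤ I + 1 / ((N : ℝ) + 1) := fun k hk => by
        refine (hu k).le.trans ?_
        have : (N : ℝ) ≤ k := by exact_mod_cast hk
        gcongr
      obtain ⟨γ, hγ, hγc⟩ := hconv _ (hud n) _ (hud m)
      have h1 := hγc (1 / 2) (by norm_num)
      have h2 := val_le_of_le hbot h1
      have h3 := hIle _ (mem_dom_of_le h1)
      have h4 := h.sq_dist_midpoint_le hD (hdiam _ hx _ (hud n)) (hdiam _ hx _ (hud m))
        (hdiam _ (hud n) _ (hud m)) hγ
      have h5 := hbound n hn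
      have h6 := hbound m hm
      simp only [hψ] at h3 h5 h6
      set l := dist (u n) (u m) ^ 2
      have hl : 0 ≤ l := by positivity
      have h7 : dist x (γ (1 / 2)) ^ 2 / (2 * τ) ≤ (dist x (u n) ^ 2 / (2 * τ) +
          dist x (u m) ^ 2 / (2 * τ)) / 2 - (|lam| + 1) / 2 * l := by
        rw [div_le_iff₀ (by positivity)]
        have e : ((dist x (u n) ^ 2 / (2 * τ) + dist x (u m) ^ 2 / (2 * τ)) / 2 -
            (|lam| + 1) / 2 * l) * (2 * τ) = (dist x (u n) ^ 2 + dist x (u m) ^ 2) / 2 -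
            τ * (|lam| + 1) * l := by field_simp
        rw [e]
        have := mul_le_mul_of_nonneg_right hτs.le hl
        linarith
      have h8 := mul_le_mul_of_nonneg_right (neg_le_abs lam) hl
      have h9 := mul_nonneg (abs_nonneg lam) hl
      linarith
    · have h1 : Tendsto (fun n : ℕ => 1 / ((n : ℝ) + 1)) atTop (𝓝 0) :=
        tendsto_one_div_add_atTop_nhds_zero_nat
      have h2 : Continuous fun e : ℝ => √(2 * e) := by fun_prop
      simpa [Function.comp_def] using (h2.tendsto 0).comp h1
  obtain ⟨z, hz⟩ := cauchySeq_tendsto_of_complete hcau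
  have h1 : Tendsto (fun n : ℕ => 1 / ((n : ℝ) + 1)) atTop (𝓝 0) :=
    tendsto_one_div_add_atTop_nhds_zero_nat
  have hlim := mem_dom_and_val_le_of_tendsto hbot hlsc hz
    (b := fun n : ℕ => I + 1 / ((n : ℝ) + 1) - dist x (u n) ^ 2 / (2 * τ))
    (c := I + 0 - dist x z ^ 2 / (2 * τ))
    (Eventually.of_forall hud)
    (Eventually.of_forall fun n => by
      have := (hu n).le
      simp only [hψ] at this
      linarith)
    ((tendsto_const_nhds.add h1).sub (((tendsto_const_nhds.dist hz).pow 2).div_const _))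
  refine ⟨z, mem_proxSet hbot hlim.1 fun y hy => ?_⟩
  have := hIle y hy
  simp only [hψ] at this
  linarith [hlim.2]

lemma IsCAT1.flowSetting [CompleteSpace X] (h : IsCAT1 X) (hbot : ∀ x, φ x ≠ ⊥)
    (hlsc : LowerSemicontinuous φ) {lam D : ℝ} (hconv : IsLambdaConvex φ lam)
    (hD0 : 0 ≤ D) (hD : D < Real.pi / 2) (hdiam : ∀ x ∈ dom φ, ∀ y ∈ dom φ, dist x y ≤ D) :
    FlowSetting φ 8 |lam| where
  bot := hbot
  lsc := hlsc
  C_nonneg := by norm_num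
  L_nonneg := abs_nonneg _
  prox := by
    have hcD : 0 < Real.cos D := Real.cos_pos_of_mem_Ioo ⟨by linarith [Real.pi_pos], hD⟩
    have hpi := Real.pi_pos
    refine ⟨Real.cos D / Real.pi ^ 2 / (|lam| + 1), by positivity, fun x hx τ hτ hτs => ?_⟩
    rw [lt_div_iff₀ (by positivity)] at hτs
    exact h.proxSet_nonempty hbot hlsc hconv hD hdiam hx hτ hτs
  evi τ hτ x hx y hy z hz := h.evi hbot hconv hD hdiam hτ hx hy hz

/-! ### The commutative setting -/

lemma CommutativeSetting.flowSetting (hbot : ∀ x, φ x ≠ ⊥) (hlsc : LowerSemicontinuous φ)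
    {lam K : ℝ} (h : CommutativeSetting φ lam K) (hcoer : Coercive φ) :
    FlowSetting φ |K| |lam| where
  bot := hbot
  lsc := hlsc
  C_nonneg := abs_nonneg _
  L_nonneg := abs_nonneg _
  prox := by
    obtain ⟨τs, hτs, hc⟩ := hcoer
    obtain ⟨r, hr, hrτ⟩ := ENNReal.lt_iff_exists_nnreal_btwn.1 hτs
    refine ⟨r, by exact_mod_cast hr, fun x _ τ hτ hτr => (hc x τ hτ ?_).2⟩
    refine lt_trans ?_ hrτ
    rw [← ENNReal.ofReal_coe_nnreal]
    exact (ENNReal.ofReal_lt_ofReal_iff (hτ.trans hτr)).2 hτr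
  evi τ hτ x hx y hy z hz := by
    obtain ⟨hzd, hmin⟩ := prox_spec hbot hx hz
    obtain ⟨Γ, hgeo, hjoin, hcomm, hK, hφ⟩ := h
    -- Both geodesics start at the minimizer `z`. Commutativity identifies the derivative of
    -- `d²(x,·)` towards `y`, bounded below by minimality, with that of `d²(y,·)` towards `x`,
    -- bounded above by `K`-convexity.
    obtain ⟨γ, hγ, hγ0, hγ1⟩ := hjoin z x
    obtain ⟨η, hη, hη0, hη1⟩ := hjoin z y
    obtain ⟨l, hl1, hl2⟩ := hcomm γ hγ η hη (hγ0.trans hη0.symm)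
    have hKγ := hK γ hγ y
    have hφη := hφ η hη (hη0 ▸ hzd) (hη1 ▸ hy)
    rw [hγ0, hγ1] at hKγ
    rw [hη0, hη1] at hφη
    rw [hγ0, hη1] at hl1
    rw [hγ1, hγ0] at hl2
    have hmem : ∀ᶠ s : ℝ in 𝓝[>] 0, s ∈ Ioc (0 : ℝ) 1 := by
      filter_upwards [Ioc_mem_nhdsGT zero_lt_one] with s hs using hs
    have hlow : 2 * τ * (val φ z - val φ y + lam / 2 * (1 - 0) * dist z y ^ 2) ≤ l := by
      have hc : Continuous fun s : ℝ =>
        2 * τ * (val φ z - val φ y + lam / 2 * (1 - s) * dist z y ^ 2) := by fun_prop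
      refine le_of_tendsto_of_tendsto ((hc.tendsto 0).mono_left nhdsWithin_le_nhds) hl2 ?_
      filter_upwards [hmem] with s hs
      have h1 := hφη s ⟨hs.1.le, hs.2⟩
      have h2 := val_le_of_le hbot h1
      have h3 := hmin _ (mem_dom_of_le h1)
      have h4 : (dist x z ^ 2 - dist x (η s) ^ 2) / (2 * τ) ≤ val φ (η s) - val φ z := by
        rw [sub_div]; linarith
      rw [div_le_iff₀ (by positivity)] at h4
      have h5 := mul_le_mul_of_nonneg_left h2 hτ.le
      rw [le_div_iff₀ hs.1, dist_comm (η s), dist_comm z x]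
      linarith
    have hupp : l ≤ dist y x ^ 2 - dist y z ^ 2 - K / 2 * (1 - 0) * dist z x ^ 2 := by
      have hc : Continuous fun s : ℝ =>
        dist y x ^ 2 - dist y z ^ 2 - K / 2 * (1 - s) * dist z x ^ 2 := by fun_prop
      refine le_of_tendsto_of_tendsto hl1 ((hc.tendsto 0).mono_left nhdsWithin_le_nhds) ?_
      filter_upwards [hmem] with s hs
      have h1 := hKγ s ⟨hs.1.le, hs.2⟩
      simp only [EReal.toReal_coe] at h1
      have h2 : dist y (γ s) ^ 2 ≤ (1 - s) * dist y z ^ 2 + s * dist y x ^ 2 -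
        K / 2 * (1 - s) * s * dist z x ^ 2 := by exact_mod_cast h1
      rw [div_le_iff₀ hs.1, dist_comm (γ s), dist_comm z y]
      linarith
    rw [dist_comm y x, dist_comm y z, dist_comm z x] at hupp
    have h1 := mul_le_mul_of_nonneg_left (neg_le_abs lam) (mul_nonneg hτ.le (sq_nonneg (dist z y)))
    have h2 := mul_le_mul_of_nonneg_right (neg_le_abs K) (sq_nonneg (dist x z))
    have h3 := mul_nonneg (abs_nonneg K) (sq_nonneg (dist x z))
    linarith

end Cat

section Restart

variable {X : Type*} [MetricSpace X] {φ : X → EReal}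

/-! ### Restriction of the potential to a ball -/

lemma restrictBall_of_le {c z : X} (h : dist z c ≤ Real.pi / 6) : restrictBall φ c z = φ z :=
  if_pos h

lemma le_restrictBall (c z : X) : φ z ≤ restrictBall φ c z := by
  unfold restrictBall
  split_ifs
  · exact le_rfl
  · exact le_top

lemma mem_dom_restrictBall {c z : X} :
    z ∈ dom (restrictBall φ c) ↔ dist z c ≤ Real.pi / 6 ∧ z ∈ dom φ := by
  by_cases h : dist z c ≤ Real.pi / 6 <;> simp [dom, restrictBall, h]

lemma center_mem_dom_restrictBall {c : X} (hc : c ∈ dom φ) : c ∈ dom (restrictBall φ c) :=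
  mem_dom_restrictBall.2 ⟨by rw [dist_self]; positivity, hc⟩

lemma restrictBall_ne_bot (hbot : ∀ x, φ x ≠ ⊥) (c z : X) : restrictBall φ c z ≠ ⊥ := fun h =>
  hbot z (le_bot_iff.1 (h ▸ le_restrictBall c z))

lemma lowerSemicontinuous_restrictBall (hlsc : LowerSemicontinuous φ) (c : X) :
    LowerSemicontinuous (restrictBall φ c) := by
  intro z a ha
  by_cases h : dist z c ≤ Real.pi / 6
  · rw [restrictBall_of_le h] at ha
    filter_upwards [hlsc z a ha] with w hw
    exact lt_of_lt_of_le hw (le_restrictBall c w)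
  · have hopen : ∀ᶠ w in 𝓝 z, Real.pi / 6 < dist w c :=
      (continuous_id.dist continuous_const).continuousAt.eventually (lt_mem_nhds (not_le.1 h))
    filter_upwards [hopen] with w hw
    have e1 : restrictBall φ c w = ⊤ := if_neg (not_le.2 hw)
    have e2 : restrictBall φ c z = ⊤ := if_neg h
    rw [e2] at ha
    rw [e1]
    exact ha

lemma dist_le_of_mem_dom_restrictBall {c x y : X} (hx : x ∈ dom (restrictBall φ c))
    (hy : y ∈ dom (restrictBall φ c)) : dist x y ≤ Real.pi / 3 := by
  have h1 := (mem_dom_restrictBall.1 hx).1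
  have h2 := (mem_dom_restrictBall.1 hy).1
  have := dist_triangle_right x y c
  linarith

lemma IsCAT1.isLambdaConvex_restrictBall (h : IsCAT1 X) {lam : ℝ} (hconv : IsLambdaConvex φ lam)
    (c : X) : IsLambdaConvex (restrictBall φ c) lam := by
  intro x hx y hy
  have hxy := dist_le_of_mem_dom_restrictBall hx hy
  obtain ⟨hxc, hxd⟩ := mem_dom_restrictBall.1 hx
  obtain ⟨hyc, hyd⟩ := mem_dom_restrictBall.1 hy
  obtain ⟨γ, hγ, hγc⟩ := hconv x hxd y hyd
  refine ⟨γ, hγ, fun t ht => ?_⟩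
  have hpi := Real.pi_pos
  have hball : dist (γ t) c ≤ Real.pi / 6 := by
    rw [dist_comm]
    exact h.dist_le_of_dist_le (by linarith) (by rwa [dist_comm]) (by rwa [dist_comm])
      (by linarith) hγ ht
  rw [restrictBall_of_le hball, restrictBall_of_le hxc, restrictBall_of_le hyc]
  exact hγc t ht

lemma IsCAT1.flowSetting_restrictBall [CompleteSpace X] (h : IsCAT1 X) (hbot : ∀ x, φ x ≠ ⊥)
    (hlsc : LowerSemicontinuous φ) {lam : ℝ} (hconv : IsLambdaConvex φ lam) (c : X) :
    FlowSetting (restrictBall φ c) 8 |lam| :=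
  h.flowSetting (restrictBall_ne_bot hbot c) (lowerSemicontinuous_restrictBall hlsc c)
    (h.isLambdaConvex_restrictBall hconv c) (D := Real.pi / 3) (by positivity)
    (by linarith [Real.pi_pos]) fun _ hx _ hy => dist_le_of_mem_dom_restrictBall hx hy

lemma localSlope_restrictBall (c : X) : localSlope (restrictBall φ c) c = localSlope φ c := by
  refine limsup_congr ?_
  have hpi := Real.pi_pos
  have hball : ∀ᶠ y in 𝓝[≠] c, dist y c ≤ Real.pi / 6 :=
    nhdsWithin_le_nhds (Metric.closedBall_mem_nhds c (by positivity))
  filter_upwards [hball] with y hy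
  rw [restrictBall_of_le hy, restrictBall_of_le (by rw [dist_self]; positivity)]

lemma IsGradientCurve.energy_restrictBall {c : X} {η : ℝ≥0 → X}
    (hη : IsGradientCurve (restrictBall φ c) c η) (hbot : ∀ x, φ x ≠ ⊥)
    (hlsc : LowerSemicontinuous φ) (hc : c ∈ dom φ) (t : ℝ≥0) :
    η t ∈ dom φ ∧ val φ (η t) ≤ val φ c ∧
      dist c (η t) ^ 2 ≤ 2 * t * (val φ c - val φ (η t)) := by
  obtain ⟨h1, h2, h3⟩ := hη.energy (restrictBall_ne_bot hbot c)
    (lowerSemicontinuous_restrictBall hlsc c) (center_mem_dom_restrictBall hc) t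
  have h4 := mem_dom_restrictBall.1 h1
  simp only [val, restrictBall_of_le h4.1,
    restrictBall_of_le (φ := φ) (show dist c c ≤ Real.pi / 6 by rw [dist_self]; positivity)]
    at h2 h3
  exact ⟨h4.2, h2, h3⟩

/-! ### Hitting times -/

lemma dist_eq_of_hittingTime_eq {c : X} {η : ℝ≥0 → X} (hη : Continuous η) {a : ℝ≥0}
    (h : hittingTime c η = a) : dist (η a) c = Real.pi / 6 := by
  set S : Set ℝ≥0 := {t | dist (η t) c = Real.pi / 6} with hS
  have hne : S.Nonempty := by
    by_contra hcon
    have h' : ∀ t, ¬ dist (η t) c = Real.pi / 6 := fun t ht => hcon ⟨t, ht⟩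
    simp [hittingTime, h'] at h
  have hcl : IsClosed S := isClosed_eq (hη.dist continuous_const) continuous_const
  have hm : sInf S ∈ S := hcl.csInf_mem hne (OrderBot.bddBelow S)
  have heq : hittingTime c η = (sInf S : ℝ≥0) :=
    le_antisymm (iInf₂_le (sInf S) hm)
      (le_iInf₂ fun t ht => ENNReal.coe_le_coe.2 (csInf_le (OrderBot.bddBelow S) ht))
  rw [h, ENNReal.coe_inj] at heq
  rw [heq]
  exact hm

lemma hittingTime_pos {c : X} {η : ℝ≥0 → X} (hη : Continuous η) (h0 : η 0 = c) :
    0 < hittingTime c η := by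
  refine pos_iff_ne_zero.2 fun h => ?_
  have := dist_eq_of_hittingTime_eq (a := 0) hη h
  rw [h0, dist_self] at this
  linarith [Real.pi_pos]

/-- The restarted flow does not accumulate: a sequence of points at mutual consecutive distance `r`,
reached by energy-controlled steps, takes infinite time. -/
lemma restart_times_unbounded (hbot : ∀ x, φ x ≠ ⊥) (hlsc : LowerSemicontinuous φ) {lam : ℝ}
    (hconv : IsLambdaConvex φ lam) {r : ℝ} (hr : 0 < r) {c : ℕ → X} {σ : ℕ → ℝ}
    (hσ : Monotone σ) (hcd : ∀ n, c n ∈ dom φ) (hval : ∀ n, val φ (c (n + 1)) ≤ val φ (c n))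
    (hdist : ∀ n, dist (c n) (c (n + 1)) = r)
    (hstep : ∀ n, r ^ 2 ≤ 2 * (σ (n + 1) - σ n) * (val φ (c n) - val φ (c (n + 1)))) :
    ¬ BddAbove (range σ) := by
  intro hbdd
  have hlim := tendsto_atTop_ciSup hσ hbdd
  set B := 1 + |lam| with hB
  have hBpos : 0 < B := by positivity
  -- The remaining time is made small against `B` before the centre `c m`, and hence `A`, is known:
  -- `B` must not depend on the centre.
  obtain ⟨m, hm⟩ := (hlim.eventually (lt_mem_nhds
    (sub_lt_self (⨆ i, σ i) (by positivity : 0 < 1 / (4 * B))))).exists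
  have hθ : ∀ n, σ (m + n) - σ m ≤ 1 / (4 * B) := fun n => by
    have := le_ciSup hbdd (m + n)
    linarith
  have hanti : Antitone fun n => val φ (c n) := antitone_nat_of_succ_le hval
  have hcs : ∀ n : ℕ, (n * r) ^ 2 ≤
      2 * (σ (m + n) - σ m) * (val φ (c m) - val φ (c (m + n))) := by
    intro n
    induction n with
    | zero => simp
    | succ n ih =>
      have h1 := sq_add_le_of_sq_le (sub_nonneg.2 (hσ (Nat.le_add_right m n)))
        (sub_nonneg.2 (hσ (Nat.le_succ (m + n))))
        (sub_nonneg.2 (hanti (Nat.le_add_right m n)))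
        (sub_nonneg.2 (hanti (Nat.le_succ (m + n)))) ih (hstep (m + n))
      push_cast
      rw [← add_assoc]
      calc ((n + 1) * r) ^ 2 = (n * r + r) ^ 2 := by ring
        _ ≤ _ := h1
        _ = _ := by simp only [Nat.succ_eq_add_one]; ring
  have hd : ∀ n : ℕ, dist (c m) (c (m + n)) ≤ n * r := by
    intro n
    induction n with
    | zero => simp
    | succ n ih =>
      have h1 := dist_triangle (c m) (c (m + n)) (c (m + n + 1))
      rw [hdist] at h1
      push_cast
      rw [← add_assoc]
      linarith
  obtain ⟨A, hA, hlow⟩ := exists_val_sub_le hbot hlsc hconv (hcd m)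
  -- After `n` steps the drop is at least of order `(n r)²` over the time, yet at most `A + B (n
  -- r)²`; with time at most `1/(4B)` half of `(n r)²` is absorbed.
  have hbound : ∀ n : ℕ, (n * r) ^ 2 ≤ A / B := by
    intro n
    have h1 : val φ (c m) - val φ (c (m + n)) ≤ A + B * (n * r) ^ 2 := by
      refine (hlow _ (hcd _)).trans ?_
      have := hd n
      gcongr
    have h2 : 0 ≤ val φ (c m) - val φ (c (m + n)) := sub_nonneg.2 (hanti (Nat.le_add_right m n))
    have h3 : (n * r) ^ 2 ≤ 2 * (1 / (4 * B)) * (A + B * (n * r) ^ 2) := by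
      refine (hcs n).trans ?_
      have := hθ n
      gcongr
    have h4 : 2 * (1 / (4 * B)) * (A + B * (n * r) ^ 2) = (A / B + (n * r) ^ 2) / 2 := by
      field_simp
      ring
    linarith
  obtain ⟨n, hn⟩ := exists_nat_gt (√(A / B) / r)
  rw [div_lt_iff₀ hr] at hn
  have h1 := Real.lt_sq_of_sqrt_lt hn
  linarith [hbound n]

/-! ### Existence and uniqueness of restarted curves -/

lemma IsCAT1.restartedCurve_unique [CompleteSpace X] (h : IsCAT1 X) (hbot : ∀ x, φ x ≠ ⊥)
    (hlsc : LowerSemicontinuous φ) {lam : ℝ} (hconv : IsLambdaConvex φ lam) {x₀ : X}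
    (hx₀ : x₀ ∈ dom φ) {ξ ζ : ℝ≥0 → X} (hξ : IsRestartedCurve φ x₀ ξ)
    (hζ : IsRestartedCurve φ x₀ ζ) : ξ = ζ := by
  obtain ⟨hξ0, s, hs0, hsex, hs⟩ := hξ
  obtain ⟨hζ0, s', hs'0, -, hs'⟩ := hζ
  -- The alternative is needed because restart times following an infinite one are unconstrained.
  have key : ∀ i, (∃ a : ℝ≥0, s i = a ∧ s' i = a ∧ ξ a ∈ dom φ ∧ ∀ t ≤ a, ξ t = ζ t) ∨
      ∀ t, ξ t = ζ t := by
    intro i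
    induction i with
    | zero =>
      refine Or.inl ⟨0, by simp [hs0], by simp [hs'0], by rwa [hξ0], fun t ht => ?_⟩
      rw [le_antisymm ht zero_le, hξ0, hζ0]
    | succ i ih =>
      rcases ih with ⟨a, ha, ha', had, hag⟩ | hall
      · obtain ⟨η, hη, hsucc, hηeq⟩ := hs i a ha
        obtain ⟨η', hη', hsucc', hηeq'⟩ := hs' i a ha'
        rw [← hag a le_rfl] at hη' hsucc'
        have hηη' : η = η' := (h.flowSetting_restrictBall hbot hlsc hconv
          (ξ a)).gradientCurve_unique (center_mem_dom_restrictBall had) hη hη'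
        subst hηη'
        have hss : s' (i + 1) = s (i + 1) := by rw [hsucc, hsucc', ha, ha']
        have hagree : ∀ t : ℝ≥0, (t : ℝ≥0∞) ≤ s (i + 1) → ξ t = ζ t := by
          intro t ht
          rcases le_total t a with hta | hta
          · exact hag t hta
          · have e : a + (t - a) = t := add_tsub_cancel_of_le hta
            have h1 := hηeq (t - a) (by rwa [e])
            have h2 := hηeq' (t - a) (by rwa [e, hss])
            rw [e] at h1 h2
            rw [h1, h2]
        rcases eq_or_ne (s (i + 1)) ⊤ with htop | htop
        · exact Or.inr fun t => hagree t (htop ▸ le_top)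
        · obtain ⟨b, hb⟩ : ∃ b : ℝ≥0, (b : ℝ≥0∞) = s (i + 1) := ⟨_, ENNReal.coe_toNNReal htop⟩
          have hab : a ≤ b := by
            rw [← ENNReal.coe_le_coe, hb, hsucc, ha]
            exact le_self_add
          refine Or.inl ⟨b, hb.symm, by rw [hss, hb], ?_, fun t ht => hagree t ?_⟩
          · have e : a + (b - a) = b := add_tsub_cancel_of_le hab
            have h1 := hηeq (b - a) (by rw [e, hb])
            rw [e] at h1
            rw [h1]
            exact (hη.energy_restrictBall hbot hlsc had _).1
          · rw [← hb]; exact ENNReal.coe_le_coe.2 ht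
      · exact Or.inr hall
  funext t
  obtain ⟨i, hi⟩ := hsex t
  rcases key i with ⟨a, ha, -, -, hag⟩ | hall
  · rw [ha] at hi
    exact hag t (ENNReal.coe_lt_coe.1 hi).le
  · exact hall t

lemma IsCAT1.exists_restartedCurve [CompleteSpace X] (h : IsCAT1 X) (hbot : ∀ x, φ x ≠ ⊥)
    (hlsc : LowerSemicontinuous φ) {lam : ℝ} (hconv : IsLambdaConvex φ lam) {x₀ : X}
    (hx₀ : x₀ ∈ dom φ) : ∃ ξ, IsRestartedCurve φ x₀ ξ := by
  have hS := h.flowSetting_restrictBall hbot hlsc hconv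
  have hex : ∀ c ∈ dom φ, ∃ η, IsGradientCurve (restrictBall φ c) c η := fun c hc =>
    (hS c).exists_gradientCurve (center_mem_dom_restrictBall hc)
  choose! η hη using hex
  have hη0 : ∀ c ∈ dom φ, η c 0 = c := fun c hc => (hη c hc).apply_zero
  have hηc : ∀ c ∈ dom φ, Continuous (η c) := fun c hc =>
    (hS c).continuous_gradientCurve (center_mem_dom_restrictBall hc) (hη c hc)
  set H : X → ℝ≥0∞ := fun c => hittingTime c (η c) with hH
  have hHpos : ∀ c ∈ dom φ, 0 < H c := fun c hc => hittingTime_pos (hηc c hc) (hη0 c hc)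
  -- An infinite hitting time gives `toNNReal = 0`, so the centre is merely repeated; harmless,
  -- since `s` is `∞` from then on.
  obtain ⟨c, hc0, hcs⟩ : ∃ c : ℕ → X, c 0 = x₀ ∧ ∀ n, c (n + 1) = η (c n) (H (c n)).toNNReal :=
    ⟨fun n => Nat.rec x₀ (fun _ z => η z (H z).toNNReal) n, rfl, fun _ => rfl⟩
  have hcd : ∀ n, c n ∈ dom φ := by
    intro n
    induction n with
    | zero => rw [hc0]; exact hx₀
    | succ n ih => rw [hcs]; exact ((hη _ ih).energy_restrictBall hbot hlsc ih _).1
  obtain ⟨s, hs0, hss⟩ : ∃ s : ℕ → ℝ≥0∞, s 0 = 0 ∧ ∀ n, s (n + 1) = s n + H (c n) :=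
    ⟨fun n => Nat.rec 0 (fun n z => z + H (c n)) n, rfl, fun _ => rfl⟩
  have hsmono : Monotone s := monotone_nat_of_le_succ fun n => by rw [hss]; exact le_self_add
  have hsex : ∀ t : ℝ≥0, ∃ i, (t : ℝ≥0∞) < s (i + 1) := by
    intro t
    by_contra hcon
    push Not at hcon
    have hst : ∀ i, s i ≤ t := fun i => (hsmono (Nat.le_succ i)).trans (hcon i)
    have hsne : ∀ i, s i ≠ ⊤ := fun i => ((hst i).trans_lt ENNReal.coe_lt_top).ne
    have hHne : ∀ n, H (c n) ≠ ⊤ := fun n hn => hsne (n + 1) (by rw [hss, hn, add_top])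
    have hHeq : ∀ n, hittingTime (c n) (η (c n)) = (H (c n)).toNNReal := fun n =>
      (ENNReal.coe_toNNReal (hHne n)).symm
    have hdist : ∀ n, dist (c n) (c (n + 1)) = Real.pi / 6 := fun n => by
      rw [hcs, dist_comm]
      exact dist_eq_of_hittingTime_eq (hηc _ (hcd n)) (hHeq n)
    have hen := fun n => (hη _ (hcd n)).energy_restrictBall hbot hlsc (hcd n) (H (c n)).toNNReal
    refine restart_times_unbounded hbot hlsc hconv (by positivity : 0 < Real.pi / 6)
      (c := c) (σ := fun n => (s n).toReal) (fun i j hij => ENNReal.toReal_mono (hsne j) (hsmono hij))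
      hcd (fun n => by rw [hcs]; exact (hen n).2.1) hdist (fun n => ?_) ⟨t, ?_⟩
    · have h1 := (hen n).2.2
      rw [← hcs, hdist] at h1
      rw [hss, ENNReal.toReal_add (hsne n) (hHne n), add_sub_cancel_left]
      exact h1
    · rintro _ ⟨n, rfl⟩
      exact ENNReal.toReal_le_coe_of_le_coe (hst n)
  classical
  -- `Nat.find` selects the piece with `s i ≤ t < s (i+1)`, so the truncated subtraction is exact.
  -- At a finite restart time the next piece is used, and it starts where the previous one ended.
  set ξ : ℝ≥0 → X := fun t => η (c (Nat.find (hsex t))) (t - (s (Nat.find (hsex t))).toNNReal)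
    with hξ
  have hξeq : ∀ n (a t : ℝ≥0), s n = a → ((a + t : ℝ≥0) : ℝ≥0∞) < s (n + 1) →
      ξ (a + t) = η (c n) t := by
    intro n a t hn hlt
    have hfind : Nat.find (hsex (a + t)) = n := by
      rw [Nat.find_eq_iff]
      refine ⟨hlt, fun j hj => not_lt.2 ?_⟩
      calc s (j + 1) ≤ s n := hsmono hj
        _ = a := hn
        _ ≤ _ := ENNReal.coe_le_coe.2 le_self_add
    simp only [hξ, hfind, hn, ENNReal.toNNReal_coe, add_tsub_cancel_left]
  have hlt : ∀ n (a : ℝ≥0), s n = a → s n < s (n + 1) := fun n a hn => by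
    rw [hss]
    exact ENNReal.lt_add_right (by rw [hn]; exact ENNReal.coe_ne_top) (hHpos _ (hcd n)).ne'
  have hξnode : ∀ n (a : ℝ≥0), s n = a → ξ a = c n := by
    intro n a hn
    have h1 := hξeq n a 0 hn (by rw [add_zero, ← hn]; exact hlt n a hn)
    rwa [add_zero, hη0 _ (hcd n)] at h1
  refine ⟨ξ, ?_, s, hs0, fun t => ?_, fun n a hn => ?_⟩
  · rw [hξnode 0 0 (by simp [hs0]), hc0]
  · obtain ⟨i, hi⟩ := hsex t
    exact ⟨i + 1, hi⟩
  · rw [hξnode n a hn]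
    refine ⟨η (c n), hη _ (hcd n), hss n, fun t ht => ?_⟩
    rcases ht.lt_or_eq with hlt' | heq
    · exact hξeq n a t hn hlt'
    · rw [hξnode (n + 1) (a + t) heq.symm, hcs]
      congr 1
      rw [hss, hn, ENNReal.coe_add] at heq
      have := (ENNReal.add_right_inj ENNReal.coe_ne_top).1 heq
      rw [← this, ENNReal.toNNReal_coe]

lemma restartedFlow_eq {x₀ : X} {ξ : ℝ≥0 → X} (h : ∃! ξ, IsRestartedCurve φ x₀ ξ)
    (hξ : IsRestartedCurve φ x₀ ξ) (t : ℝ≥0) : restartedFlow φ t x₀ = ξ t := by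
  have h1 : IsRestartedCurve φ x₀
      (@Classical.epsilon (ℝ≥0 → X) ⟨fun _ => x₀⟩ (IsRestartedCurve φ x₀)) :=
    Classical.epsilon_spec ⟨ξ, hξ⟩
  exact congrFun (h.unique h1 hξ) t

/-- Only the first ball matters: `ξ` follows `η` up to the hitting time, and restriction to the ball
does not change the slope at its centre. -/
lemma IsCAT1.restartedFlow_stationary_iff [CompleteSpace X] (h : IsCAT1 X) (hbot : ∀ x, φ x ≠ ⊥)
    (hlsc : LowerSemicontinuous φ) {lam : ℝ} (hconv : IsLambdaConvex φ lam) {x₀ : X}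
    (hx₀ : x₀ ∈ dom φ) :
    (∃! ξ, IsRestartedCurve φ x₀ ξ) ∧
      (localSlope φ x₀ = 0 ↔ ∀ t : ℝ≥0, 0 < t → restartedFlow φ t x₀ = x₀) := by
  obtain ⟨ξ, hξ⟩ := h.exists_restartedCurve hbot hlsc hconv hx₀
  have huniq : ∃! ξ, IsRestartedCurve φ x₀ ξ :=
    ⟨ξ, hξ, fun ζ hζ => h.restartedCurve_unique hbot hlsc hconv hx₀ hζ hξ⟩
  refine ⟨huniq, ?_⟩
  simp only [restartedFlow_eq huniq hξ]
  have hS := h.flowSetting_restrictBall hbot hlsc hconv x₀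
  have hx₀' := center_mem_dom_restrictBall hx₀
  obtain ⟨hξ0, s, hs0, -, hs⟩ := hξ
  obtain ⟨η, hη, hs1, hξη⟩ := hs 0 0 (by simp [hs0])
  rw [hξ0] at hη hs1
  simp only [hs0, zero_add] at hs1 hξη
  rw [← localSlope_restrictBall, hS.localSlope_eq_zero_iff
    (h.isLambdaConvex_restrictBall hconv x₀) hx₀' hη]
  have hηc := hS.continuous_gradientCurve hx₀' hη
  constructor
  · intro hconst t ht
    have hconst' : ∀ t, η t = x₀ := fun t => by
      rcases eq_or_lt_of_le (zero_le : 0 ≤ t) with rfl | ht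
      · exact hη.apply_zero
      · exact hconst t ht
    rw [hξη t, hconst' t]
    rw [hs1]
    refine le_iInf₂ fun r hr => ?_
    rw [hconst', dist_self] at hr
    linarith [Real.pi_pos]
  · intro hconst t ht
    -- At a finite hitting time `η`, hence `ξ`, would be at distance `π/6` from `x₀`.
    have htop : hittingTime x₀ η = ⊤ := by
      by_contra hne
      obtain ⟨b, hb⟩ : ∃ b : ℝ≥0, (b : ℝ≥0∞) = hittingTime x₀ η := ⟨_, ENNReal.coe_toNNReal hne⟩
      have h1 := dist_eq_of_hittingTime_eq hηc hb.symm
      have hpi := Real.pi_pos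
      have h2 := hξη b (by rw [hs1, hb])
      rcases eq_or_lt_of_le (zero_le : 0 ≤ b) with rfl | hb0
      · rw [hη.apply_zero, dist_self] at h1; linarith
      · rw [← h2, hconst b hb0, dist_self] at h1; linarith
    rw [← hξη t (by rw [hs1, htop]; exact le_top), hconst t ht]

end Restart

end GradFlow

/-! ### The theorem -/

open GradFlow
theorem theorem4p7 {X : Type*} [MetricSpace X] [CompleteSpace X]
    (φ : X → EReal) (hbot : ∀ x, φ x ≠ ⊥) (hlsc : LowerSemicontinuous φ)
    (lam : ℝ) (hconv : IsLambdaConvex φ lam)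
    (x₀ : X) (hx₀ : x₀ ∈ dom φ) :
    ((IsCAT1 X ∧ Metric.ediam (Set.univ : Set X) < ENNReal.ofReal (Real.pi / 2)) ∨
        ((∃ K : ℝ, CommutativeSetting φ lam K) ∧ Coercive φ) →
      (∃! ξ : NNReal → X, IsGradientCurve φ x₀ ξ) ∧
      (localSlope φ x₀ = 0 ↔ ∀ t : NNReal, 0 < t → gradientFlow φ t x₀ = x₀)) ∧
    (IsCAT1 X →
      (∃! ξ : NNReal → X, IsRestartedCurve φ x₀ ξ) ∧
      (localSlope φ x₀ = 0 ↔ ∀ t : NNReal, 0 < t → restartedFlow φ t x₀ = x₀)) := by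
  refine ⟨?_, fun h => h.restartedFlow_stationary_iff hbot hlsc hconv hx₀⟩
  rintro (⟨h, hdiam⟩ | ⟨⟨K, h⟩, hcoer⟩)
  · have htop : Metric.ediam (Set.univ : Set X) ≠ ⊤ := (hdiam.trans ENNReal.ofReal_lt_top).ne
    refine (h.flowSetting hbot hlsc hconv (D := (Metric.ediam (Set.univ : Set X)).toReal)
      ENNReal.toReal_nonneg ?_ fun x _ y _ => ?_).gradientFlow_stationary_iff hconv hx₀
    · exact (ENNReal.lt_ofReal_iff_toReal_lt htop).1 hdiam
    · rw [dist_edist]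
      exact ENNReal.toReal_mono htop (Metric.edist_le_ediam_of_mem trivial trivial)
  · exact (h.flowSetting hbot hlsc hcoer).gradientFlow_stationary_iff hconv hx₀
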